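/- **Setting.** Let $\mathcal S\times\mathcal A$ be a compact space whose open sets are measurable, let $\mathcal M=(S_1,R,T)$ be a Markov decision process with initial state distribution $S_1$, conditional reward distribution $R(s,a)\in\mathcal P([0,1])$ and transition distribution $T(s,a)$, let $\pi$ be a policy and $0\le\gamma<1$ (infinite horizon). Put $C=1/(1-\gamma)$, $J(\pi)=\mathbb E^\pi[\sum_{h\ge1}\gamma^{h-1}r_h]$, $J(Q)=\mathbb E[Q(s_1,\pi(s_1))]$, $\Delta J(Q)=J(Q)-J(\pi)$, and $(B_\pi f)(s,a)=\mathbb E[R(s,a)+\gamma f(s',\pi(s'))\mid s'\sim T(s,a)]$. Let $\mu$ be a probability measure on $\mathcal S\times\mathcal A$ such that the law $P_h$ of $(s_h,a_h)$ is absolutely continuous with respect to $\mu$ for every $h\ge1$, and let $w=d\nu/d\mu$ with $\nu=(1-\gamma)\sum_{h\ge1}\gamma^{h-1}P_h$. The data $\mathcal D=\{(u_i,r_i,u_i')\}_{i=1}^n$ are i.i.d.: $u_i\sim\mu$, $r_i\sim R(u_i)$, $u_i'=(s_i',a_i')$ with $s_i'\sim T(u_i)$, $a_i'\sim\pi(s_i')$.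 Let $\kappa$ be a continuous, symmetric, positive definite kernel on $\mathcal S\times\mathcal A$ (that is, all its Gram matrices are positive semidefinite) with $\sup_u|\kappa(u,u)|\le1$, and let $\mathcal F_\kappa$ be its reproducing kernel Hilbert space. Let $\|g\|_{\mathcal F_\kappa^*}=\sup_{\|f\|_{\mathcal F_\kappa}\le1}\mathbb E_\mu[fg]$, let $\|w\|_{\mathcal F_\kappa}\in[0,\infty]$ be the infimum of $\|f\|_{\mathcal F_\kappa}$ over the $f\in\mathcal F_\kappa$ with $f=w$ $\mu$-almost everywhere (so it is $\infty$ if there is none), and $$\varphi(y)=C\inf_{x>0}\Big\{C\inf_{\|f\|_{\mathcal F_\kappa}\le x}\|w-f\|_{L^1(\mu)}+xy\Big\},\qquad y\ge0.$$ Let $\Omega$ be the set of all maps $X$ from the measurable functions $\mathcal S\times\mathcal A\to[0,C]$ to themselves, $\|\Delta X\|_{\mathcal F_\kappa^*}=\sup_f\|Xf-B_\pi f\|_{\mathcal F_\kappa^*}$ (supremum over measurable $f:\mathcal S\times\mathcal A\to[0,C]$), and $\mathcal C_\kappa(X)=\varphi(\|\Delta X\|_{\mathcal F_\kappa^*})$.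 For $X\in\Omega$ let $Q_0^X=0$, $Q_h^X=XQ_{h-1}^X$; for an iteration number $H^*$, let $\bar Q^X_{H^*}$ be the first $Q^X_h$, $1\le h\le H^*$, with $Q_h^X=Q_{h-1}^X$ if there is one, and $\frac1{H^*}\sum_{h=1}^{H^*}Q_h^X$ otherwise ($0$ if $H^*=0$). Let $\mathcal X\subset\Omega$ be finite, nonempty and independent of $\mathcal D$. Let $\hat X\in\mathcal X$ be any minimizer over $X\in\mathcal X$ of $\mathcal L^*(\bar Q^X_{H^*})$, where $$\mathcal L^*(f)=\frac1{n^2}\sum_{i,j=1}^n\kappa(u_i,u_j)\{r_i+\gamma f(u_i')-f(u_i)\}\{r_j+\gamma f(u_j')-f(u_j)\},$$ and let $\mathrm{Subopt}=\max\{0,|\Delta J(\bar Q^{\hat X}_{H^*})|-\min_{X\in\mathcal X}\mathcal C_\kappa(X)\}$. **Proposition.** For every measurable $Q:\mathcal S\times\mathcal A\to[0,C]$, $|\Delta J(Q)|\le\varphi(\|Q-B_\pi Q\|_{\mathcal F_\kappa^*})$; moreover $\varphi(y)\le C\|w\|_{\mathcal F_\kappa}\,y$ for all $y>0$; and if $\mathcal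 F_\kappa$ is dense in $L^1(\mu)$, then $\varphi$ is nonnegative, nondecreasing, continuous and concave on $[0,\infty)$ with $\varphi(0)=0$. Furthermore: 1. ($\mathcal C_\kappa$-optimality) If $H^*=H^*_n\ge n^{1/4}$ for all $n$, then $\mathrm{Subopt}\to0$ in probability as $n\to\infty$. 2. (Rate) There is a universal constant $K$ such that for all $n\ge1$, $H^*\ge n^{1/4}$ and $\delta\in(0,1)$, with probability at least $1-\delta$, $$\mathrm{Subopt}\le K\,C^2\,\|w\|_{\mathcal F_\kappa}\left(\frac{\max\{1,\ln(|\mathcal X|/\delta)\}}{n}\right)^{1/4}.$$ -/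

import Mathlib

open MeasureTheory ProbabilityTheory Set Filter Topology
open scoped NNReal ENNReal

namespace OPE

noncomputable section

/-! ## Markov decision processes, policies and trajectories -/

/-- A Markov decision process `(S₁, R, T)`: initial state distribution, conditional reward
distribution on `[0, 1]` and conditional distribution of the succeeding state. -/
structure MDP (S A : Type*) [MeasurableSpace S] [MeasurableSpace A] where
  init : Measure S
  reward : Kernel (S × A) ℝ
  trans : Kernel (S × A) S
  init_prob : IsProbabilityMeasure init
  reward_markov : IsMarkovKernel reward
  trans_markov : IsMarkovKernel trans
  reward_mem : ∀ u, ∀ᵐ r ∂(reward u), r ∈ Icc (0 : ℝ) 1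

attribute [instance] MDP.init_prob MDP.reward_markov MDP.trans_markov

section Dynamics

variable {S A : Type*} [MeasurableSpace S] [MeasurableSpace A]

/-- Given the current state-action pair, the law of the next one:
`s' ∼ T(s, a)` and then `a' ∼ π(s')`. -/
def MDP.step (M : MDP S A) (π : Kernel S A) : Kernel (S × A) (S × A) :=
  M.trans ⊗ₖ Kernel.prodMkLeft (S × A) π

instance (M : MDP S A) (π : Kernel S A) [IsMarkovKernel π] : IsMarkovKernel (M.step π) := by
  unfold MDP.step; infer_instance

/-- The law of the first state-action pair: `s₁ ∼ S₁`, `a₁ ∼ π(s₁)`. -/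
def MDP.start (M : MDP S A) (π : Kernel S A) : Measure (S × A) := M.init ⊗ₘ π

instance (M : MDP S A) (π : Kernel S A) [IsMarkovKernel π] :
    IsProbabilityMeasure (M.start π) := by
  unfold MDP.start; infer_instance

/-- One transition of the process `(s_h, a_h, r_h)`: given the history up to time `h`, the next
pair has law `step` and its reward is drawn from `R`. -/
def MDP.stepKernel (M : MDP S A) (π : Kernel S A) (h : ℕ) :
    Kernel (Π _ : Finset.Iic h, (S × A) × ℝ) ((S × A) × ℝ) :=
  (M.step π ⊗ₖ Kernel.prodMkLeft (S × A) M.reward).comap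
    (fun x => (x ⟨h, Finset.mem_Iic.2 le_rfl⟩).1) (by fun_prop)

instance (M : MDP S A) (π : Kernel S A) [IsMarkovKernel π] (h : ℕ) :
    IsMarkovKernel (M.stepKernel π h) := by
  unfold MDP.stepKernel; infer_instance

/-- The law of the whole trajectory `((s_h, a_h), r_h)` under the policy `π`.
Time is counted from `0`, so index `h` here is time `h + 1` in the usual notation. -/
def MDP.trajectory (M : MDP S A) (π : Kernel S A) [IsMarkovKernel π] :
    Measure (ℕ → (S × A) × ℝ) :=
  Kernel.trajMeasure (X := fun _ => (S × A) × ℝ) (M.start π ⊗ₘ M.reward) (M.stepKernel π)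

/-- The policy value `J(π) = 𝔼[∑_{h ≥ 1} γ^{h-1} r_h]` (infinite horizon). -/
def MDP.policyValue (M : MDP S A) (π : Kernel S A) [IsMarkovKernel π] (γ : ℝ≥0) : ℝ :=
  ∫ ω, ∑' h : ℕ, (γ : ℝ) ^ h * (ω h).2 ∂(M.trajectory π)

/-- The marginal law of the state-action pair at time `h` (counted from `0`). -/
def MDP.marginal (M : MDP S A) (π : Kernel S A) [IsMarkovKernel π] (h : ℕ) : Measure (S × A) :=
  (M.trajectory π).map (fun ω => (ω h).1)

/-- The discounted average `ν = (1 - γ) ∑_{h ≥ 1} γ^{h-1} P_h` of the marginals. -/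
def MDP.occupancy (M : MDP S A) (π : Kernel S A) [IsMarkovKernel π] (γ : ℝ≥0) :
    Measure (S × A) :=
  (1 - γ) • Measure.sum (fun h : ℕ => γ ^ h • M.marginal π h)

/-- The density `w = dν/dμ`. -/
def MDP.weight (M : MDP S A) (π : Kernel S A) [IsMarkovKernel π] (γ : ℝ≥0)
    (μ : Measure (S × A)) : S × A → ℝ :=
  fun u => ((M.occupancy π γ).rnDeriv μ u).toReal

/-- The Bellman operator
`(B_π f)(s, a) = 𝔼[R(s, a) + γ f(s', π(s')) | s' ∼ T(s, a)]`. -/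
def MDP.bellman (M : MDP S A) (π : Kernel S A) (γ : ℝ≥0) (f : S × A → ℝ) : S × A → ℝ :=
  fun u => ∫ r, r ∂(M.reward u) + γ * ∫ u', f u' ∂(M.step π u)

/-- The error `ΔJ(Q) = J(Q) - J(π)`, where `J(Q) = 𝔼[Q(s₁, π(s₁))]`. -/
def MDP.opeError (M : MDP S A) (π : Kernel S A) [IsMarkovKernel π] (γ : ℝ≥0)
    (Q : S × A → ℝ) : ℝ :=
  ∫ u, Q u ∂(M.start π) - M.policyValue π γ

/-- The law of one data tuple `((s, a), r, (s', a'))`: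
`(s, a) ∼ μ`, `r ∼ R(s, a)`, `s' ∼ T(s, a)`, `a' ∼ π(s')`. -/
def MDP.sampleLaw (M : MDP S A) (π : Kernel S A) (μ : Measure (S × A)) :
    Measure ((S × A) × ℝ × (S × A)) :=
  μ ⊗ₘ (M.reward ×ₖ M.step π)

/-- The law `μⁿ` of a dataset of `n` independent tuples. -/
def MDP.dataLaw (M : MDP S A) (π : Kernel S A) (μ : Measure (S × A)) (n : ℕ) :
    Measure (Fin n → (S × A) × ℝ × (S × A)) :=
  Measure.pi (fun _ => M.sampleLaw π μ)

end Dynamics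

/-! ## Range-bounded operators and the averaged iteration -/

/-- The time constant `C = 1 / (1 - γ)`. -/
def timeConst (γ : ℝ≥0) : ℝ≥0 := (1 - γ)⁻¹

/-- Measurable functions with values in `[0, C]`. -/
def BFun (U : Type*) [MeasurableSpace U] (C : ℝ≥0) : Type _ :=
  {f : U → ℝ // Measurable f ∧ ∀ u, f u ∈ Icc (0 : ℝ) C}

instance (U : Type*) [MeasurableSpace U] (C : ℝ≥0) : Zero (BFun U C) :=
  ⟨⟨fun _ => 0, measurable_const, fun _ => ⟨le_rfl, C.2⟩⟩⟩

/-- The set `Ω` of all operators on `[0, C]`-valued functions. -/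
abbrev Operator (U : Type*) [MeasurableSpace U] (C : ℝ≥0) : Type _ := BFun U C → BFun U C

section Iteration

variable {U : Type*} [MeasurableSpace U] {C : ℝ≥0}

/-- The iterates `Q_0 = 0`, `Q_h = X Q_{h-1}`. -/
def qIter (X : Operator U C) : ℕ → BFun U C
  | 0 => 0
  | h + 1 => X (qIter X h)

open Classical in
/-- The output of the averaged iteration run for `H` steps: the first iterate `Q_h` with
`Q_h = Q_{h-1}`, `1 ≤ h ≤ H`, if there is one, and otherwise the running average
`Qbar_h = (1 - 1/h) Qbar_{h-1} + (1/h) Q_h` at `h = H`.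
(Once `Q_h = Q_{h-1}` all later iterates equal `Q_h`, so that the first branch below is taken at
all later steps and keeps returning the same function.) -/
def qBar (X : Operator U C) : ℕ → U → ℝ
  | 0 => fun _ => 0
  | h + 1 =>
    if qIter X (h + 1) = qIter X h then (qIter X (h + 1)).1
    else fun u =>
      (1 - 1 / ((h : ℝ) + 1)) * qBar X h u + 1 / ((h : ℝ) + 1) * (qIter X (h + 1)).1 u

end Iteration

/-! ## Kernels and their reproducing kernel Hilbert spaces -/

/-- A symmetric positive definite kernel on `U` (all Gram matrices positive semidefinite). -/
structure PDKernel (U : Type*) where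
  toFun : U → U → ℝ
  symm : ∀ u v, toFun u v = toFun v u
  posdef : ∀ (s : Finset U) (c : U → ℝ), 0 ≤ ∑ u ∈ s, ∑ v ∈ s, c u * c v * toFun u v

namespace PDKernel

variable {U : Type*}

/-- The kernel as an operator-valued matrix. -/
def mat (κ : PDKernel U) : Matrix U U (ℝ →L[ℝ] ℝ) :=
  Matrix.of fun u v => κ.toFun u v • ContinuousLinearMap.id ℝ ℝ

theorem mat_posSemidef (κ : PDKernel U) : κ.mat.PosSemidef := by
  have h_iff := (RKHS.posSemidef_tfae (K := κ.mat)).out 0 2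
  refine h_iff.mpr ⟨?_, fun vv => ?_⟩
  · ext u v
    simp [mat, Matrix.conjTranspose_apply, κ.symm u v, star_smul,
      ContinuousLinearMap.star_eq_adjoint, ContinuousLinearMap.adjoint_id]
  · have h := κ.posdef vv.support vv
    simp only [Finsupp.sum, mat, Matrix.of_apply]
    refine h.trans_eq ?_
    simp only [RCLike.re_to_real]
    refine Finset.sum_congr rfl fun u _ => Finset.sum_congr rfl fun v _ => ?_
    simp [κ.symm u v]
    ring

instance (κ : PDKernel U) : Fact κ.mat.PosSemidef := ⟨κ.mat_posSemidef⟩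

/-- The reproducing kernel Hilbert space `F_κ` generated by `κ`. -/
abbrev Space (κ : PDKernel U) : Type _ := RKHS.OfKernel κ.mat

/-- The kernel of `F_κ` is `κ`. -/
theorem kernel_space (κ : PDKernel U) (u v : U) :
    RKHS.kernel κ.Space u v 1 = κ.toFun u v := by
  rw [RKHS.OfKernel.kernel_ofKernel]; simp [mat]

end PDKernel

section Norms

variable {U : Type*} [MeasurableSpace U]

/-- The dual norm `‖g‖_{F*} = sup_{‖f‖_F ≤ 1} 𝔼_μ[f g]`, `F = F_κ`. -/
def dualNorm (κ : PDKernel U) (μ : Measure U) (g : U → ℝ) : ℝ :=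
  ⨆ f : {f : κ.Space // ‖f‖ ≤ 1}, ∫ u, f.1 u * g u ∂μ

/-- The norm `‖g‖_F ∈ [0, ∞]` of a function `g` (determined up to null sets), `F = F_κ`; it is
infinite if `g` does not agree almost everywhere with an element of `F_κ`. -/
def spaceENorm (κ : PDKernel U) (μ : Measure U) (g : U → ℝ) : ℝ≥0∞ :=
  ⨅ (f : κ.Space) (_ : (fun u => f u) =ᵐ[μ] g), ‖f‖ₑ

/-- `F_κ` is dense in `L¹(μ)`. -/
def DenseInL1 (κ : PDKernel U) (μ : Measure U) : Prop :=
  ∀ g : U → ℝ, Integrable g μ → ∀ ε : ℝ, 0 < ε → ∃ f : κ.Space, ∫ u, |g u - f u| ∂μ < ε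

/-- The function
`φ(y) = C inf_{x > 0} {C inf_{‖f‖_F ≤ x} ‖w - f‖_{L¹(μ)} + x y}`, `F = F_κ`. -/
def linkFun (κ : PDKernel U) (μ : Measure U) (C : ℝ≥0) (w : U → ℝ) (y : ℝ) : ℝ :=
  C * ⨅ x : {x : ℝ // 0 < x},
    (C * (⨅ f : {f : κ.Space // ‖f‖ ≤ x.1}, ∫ u, |w u - f.1 u| ∂μ) + x.1 * y)

end Norms

/-- Link functions: nonnegative, nondecreasing, continuous and concave on `[0, ∞)`,
vanishing at `0`. -/
def IsLinkFunction (φ : ℝ → ℝ) : Prop :=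
  (∀ y, 0 ≤ y → 0 ≤ φ y) ∧ MonotoneOn φ (Ici 0) ∧ ContinuousOn φ (Ici 0) ∧
    ConcaveOn ℝ (Ici 0) φ ∧ φ 0 = 0

/-! ## Kernel Bellman losses, criteria and suboptimality -/

/-- The kernel Bellman loss of an operator `X` at `f`:
`n⁻² ∑ κ(u, ũ) {r + γ f(u') - X f(u)} {r̃ + γ f(ũ') - X f(ũ)}`. -/
def kernelBellmanLoss {U : Type*} (κ : PDKernel U) (γ : ℝ≥0) {n : ℕ} (D : Fin n → U × ℝ × U)
    (X : (U → ℝ) → U → ℝ) (f : U → ℝ) : ℝ :=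
  1 / (n : ℝ) ^ 2 * ∑ i, ∑ j, κ.toFun (D i).1 (D j).1 *
    ((D i).2.1 + γ * f (D i).2.2 - X f (D i).1) * ((D j).2.1 + γ * f (D j).2.2 - X f (D j).1)

/-- The fixed-point kernel Bellman loss: the loss of the identity operator. -/
def fixedPointLoss {U : Type*} (κ : PDKernel U) (γ : ℝ≥0) {n : ℕ} (D : Fin n → U × ℝ × U)
    (f : U → ℝ) : ℝ :=
  kernelBellmanLoss κ γ D id f

section Selection

variable {S A : Type*} [MeasurableSpace S] [MeasurableSpace A]

/-- The dual norm `‖ΔX‖_{F*} = sup_f ‖X f - B_π f‖_{F*}` of the Bellman error operator, the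
supremum being over all measurable `f` with values in `[0, C]`; `F = F_κ`. -/
def bellmanErrorNorm (M : MDP S A) (π : Kernel S A) (γ : ℝ≥0) (μ : Measure (S × A))
    (κ : PDKernel (S × A)) (X : Operator (S × A) (timeConst γ)) : ℝ :=
  ⨆ f : BFun (S × A) (timeConst γ), dualNorm κ μ (fun u => (X f).1 u - M.bellman π γ f.1 u)

/-- The link function `φ_{F_κ}` of the evaluation problem. -/
def klmLink (M : MDP S A) (π : Kernel S A) [IsMarkovKernel π] (γ : ℝ≥0) (μ : Measure (S × A))
    (κ : PDKernel (S × A)) : ℝ → ℝ :=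
  linkFun κ μ (timeConst γ) (M.weight π γ μ)

/-- The criterion `𝒞_κ(X) = φ_{F_κ}(‖ΔX‖_{F_κ*})`. -/
def klmCriterion (M : MDP S A) (π : Kernel S A) [IsMarkovKernel π] (γ : ℝ≥0)
    (μ : Measure (S × A)) (κ : PDKernel (S × A)) (X : Operator (S × A) (timeConst γ)) : ℝ :=
  klmLink M π γ μ κ (bellmanErrorNorm M π γ μ κ X)

/-- `Subopt(Q; 𝒳, 𝒞) = max {0, |ΔJ(Q)| - min_{X ∈ 𝒳} 𝒞(X)}`. -/
def subopt (M : MDP S A) (π : Kernel S A) [IsMarkovKernel π] (γ : ℝ≥0)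
    (cands : Finset (Operator (S × A) (timeConst γ))) (hc : cands.Nonempty)
    (crit : Operator (S × A) (timeConst γ) → ℝ) (Q : S × A → ℝ) : ℝ :=
  max 0 (|M.opeError π γ Q| - cands.inf' hc crit)

/-- A sequence of data-dependent functions `Qhat n` (based on `n` tuples) is
`(𝒳, 𝒞)`-optimal: its suboptimality tends to `0` in probability. -/
def IsOptimal (M : MDP S A) (π : Kernel S A) [IsMarkovKernel π] (γ : ℝ≥0) (μ : Measure (S × A))
    (cands : Finset (Operator (S × A) (timeConst γ))) (hc : cands.Nonempty)
    (crit : Operator (S × A) (timeConst γ) → ℝ)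
    (Qhat : ∀ n : ℕ, (Fin n → (S × A) × ℝ × (S × A)) → S × A → ℝ) : Prop :=
  ∀ ε : ℝ, 0 < ε → Tendsto
    (fun n : ℕ => M.dataLaw π μ n {D | ε < subopt M π γ cands hc crit (Qhat n D)})
    atTop (𝓝 0)

/-- `Xhat` is a selection rule for `n` data tuples that always picks a candidate `X` minimizing
the fixed-point kernel Bellman loss of the averaged estimate `qBar X H`
(ties are broken arbitrarily). -/
def IsKLMFP (γ : ℝ≥0) (κ : PDKernel (S × A))
    (cands : Finset (Operator (S × A) (timeConst γ))) (n H : ℕ)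
    (Xhat : (Fin n → (S × A) × ℝ × (S × A)) → Operator (S × A) (timeConst γ)) : Prop :=
  ∀ D, Xhat D ∈ cands ∧ ∀ X ∈ cands,
    fixedPointLoss κ γ D (qBar (Xhat D) H) ≤ fixedPointLoss κ γ D (qBar X H)

end Selection

end

end OPE

/-!
The error of a function `Q` is governed by its Bellman residual `Q - B_π Q`. Along a trajectory the
expectations of `Q` telescope, so that `ΔJ(Q)` is `C` times the mean of the residual under the
discounted occupancy `ν`, that is, `C 𝔼_μ[w (Q - B_π Q)]` (`OPE.MDP.opeError_eq_integral_weight`).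
Splitting `w = (w - f) + f` with `f ∈ F_κ` and optimizing over `f` gives
`|ΔJ(Q)| ≤ φ(‖Q - B_π Q‖_{F*})` (`OPE.abs_opeError_le_klmLink`). The function `φ` is an infimum of
affine functions with nonnegative coefficients; monotonicity, concavity, subadditivity and
continuity from the right all follow from that.

The dual norm of `g` is the norm in `F_κ` of the mean embedding `∫ g(u) κ(u, ·) dμ(u)`
(`OPE.dualNorm_eq_norm_integral`), and the loss of `f` is the squared norm of the average of the
vectors `{r + γ f(u') - f(u)} κ(u, ·)` over the data (`OPE.fixedPointLoss_eq`), whose mean is the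
embedding of the negative residual. McDiarmid's inequality in `F_κ`
(`OPE.measure_pi_norm_average_sub_ge_le`) and a union bound over the candidates thus make the root
of the loss uniformly close, within `O(C (L / n)^{1/2})` where `L = max {1, ln (|𝒳| / δ)}`, to the
dual norm of the residual.

For each candidate `X` the residual of the averaged iterate has dual norm at most `‖ΔX‖ + C / H`:
the residuals of `Q_1, …, Q_H` sum up to errors of `X` plus a telescoping remainder
(`OPE.dualNorm_qBar_sub_bellman_le`). Hence the residual of the selected function is at most
`‖ΔX‖ + η` for every `X`, with `η = 7 C (L / n)^{1/4}` (`OPE.measure_not_dualNorm_le`). For a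
minimizer `X` of the criterion this bounds the suboptimality by `φ(‖ΔX‖ + η) - φ(‖ΔX‖)`, which
tends to `0` by continuity from the right and is at most `φ(η) ≤ C ‖w‖ η` by subadditivity.
-/

namespace OPE

/-! ### Concentration of averages in a Hilbert space -/

section Concentration

variable {Z : Type*} [MeasurableSpace Z]

theorem measurable_comp_cons {n : ℕ} {F : (Fin (n + 1) → Z) → ℝ} (hF : Measurable F) :
    Measurable fun p : Z × (Fin n → Z) => F (Fin.cons p.1 p.2) := by
  refine hF.comp (measurable_pi_lambda _ fun i => ?_)
  refine Fin.cases ?_ (fun j => ?_) i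
  · simpa using measurable_fst
  · simp only [Fin.cons_succ]
    fun_prop

/-- One coordinate at a time: a function on `Zⁿ⁺¹` integrates like a function on `Z × Zⁿ`. -/
theorem integral_pi_succ {P : Measure Z} [IsProbabilityMeasure P] {n : ℕ}
    {F : (Fin (n + 1) → Z) → ℝ} (hF : Measurable F) {B : ℝ} (hB : ∀ x, |F x| ≤ B) :
    ∫ x, F x ∂(Measure.pi fun _ : Fin (n + 1) => P) =
      ∫ z, ∫ y, F (Fin.cons z y) ∂(Measure.pi fun _ : Fin n => P) ∂P := by
  have hmp := (measurePreserving_piFinSuccAbove (fun _ : Fin (n + 1) => P) 0).symm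
  have hcons : ∀ p : Z × (Fin n → Z),
      (MeasurableEquiv.piFinSuccAbove (fun _ : Fin (n + 1) => Z) 0).symm p
        = (Fin.cons p.1 p.2 : Fin (n + 1) → Z) := by
    intro p; simp [MeasurableEquiv.piFinSuccAbove, Fin.insertNthEquiv]
  have hm := measurable_comp_cons hF
  rw [← hmp.integral_comp' (g := F)]
  simp_rw [hcons]
  exact integral_prod _ (Integrable.of_bound hm.aestronglyMeasurable B (.of_forall fun _ => hB _))

/-- The exponential form of McDiarmid's inequality: a function of `n` independent variables that
moves by at most `c` when one of them changes is sub-Gaussian with variance proxy `n c² / 4`. -/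
theorem integral_exp_sub_le_of_bounded_differences (P : Measure Z) [IsProbabilityMeasure P]
    {c B : ℝ} (t : ℝ) (n : ℕ) (F : (Fin n → Z) → ℝ) (hF : Measurable F) (hB : ∀ x, |F x| ≤ B)
    (hc : ∀ i x z, |F (Function.update x i z) - F x| ≤ c) :
    ∫ x, Real.exp (t * (F x - ∫ y, F y ∂(Measure.pi fun _ : Fin n => P)))
      ∂(Measure.pi fun _ : Fin n => P) ≤ Real.exp (n * (c / 2) ^ 2 * t ^ 2 / 2) := by
  have hZ : Nonempty Z := nonempty_of_isProbabilityMeasure P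
  induction n with
  | zero =>
    have h : ∀ x : Fin 0 → Z, F x = F default := fun x => congrArg F (Subsingleton.elim _ _)
    simp [h]
  | succ n ih =>
    set Pn := Measure.pi fun _ : Fin n => P with hPn
    set G : Z → ℝ := fun z => ∫ y, F (Fin.cons z y) ∂Pn with hG
    have hFc := measurable_comp_cons hF
    have hint : ∀ z, Integrable (fun y => F (Fin.cons z y)) Pn := fun z =>
      Integrable.of_bound (hFc.comp measurable_prodMk_left).aestronglyMeasurable B
        (.of_forall fun _ => hB _)
    have hGm : Measurable G := hFc.stronglyMeasurable.integral_prod_right'.measurable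
    have hGc : ∀ z z', G z ≤ G z' + c := by
      intro z z'
      have : G z - G z' ≤ c := by
        rw [hG]; simp only
        rw [← integral_sub (hint z) (hint z')]
        refine (integral_mono ((hint z).sub (hint z')) (integrable_const c) fun y => ?_).trans
          (by simp)
        have := hc 0 (Fin.cons z' y) z
        rw [Fin.update_cons_zero] at this
        exact (abs_le.1 this).2
      linarith
    have hGB : ∀ z, |G z| ≤ B := fun z => by
      have := norm_integral_le_of_norm_le_const (μ := Pn) (f := fun y => F (Fin.cons z y))
        (.of_forall fun y => hB _)
      simpa using this
    have hbdd : BddBelow (range G) := ⟨-B, by rintro _ ⟨z, rfl⟩; exact (abs_le.1 (hGB z)).1⟩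
    have hEF : ∫ y, F y ∂(Measure.pi fun _ : Fin (n + 1) => P) = ∫ z, G z ∂P :=
      integral_pi_succ hF hB
    set m := ∫ z, G z ∂P with hm
    have hmB : |m| ≤ B := by
      have := norm_integral_le_of_norm_le_const (μ := P) (f := G) (.of_forall fun y => hGB _)
      simpa using this
    have hc0 : 0 ≤ c := by
      obtain ⟨z⟩ := hZ
      linarith [hGc z z]
    have hoeff : ∫ z, Real.exp (t * (G z - m)) ∂P ≤ Real.exp ((c / 2) ^ 2 * t ^ 2 / 2) := by
      have h := (hasSubgaussianMGF_of_mem_Icc (μ := P) (X := G) (a := ⨅ z, G z)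
        (b := (⨅ z, G z) + c) hGm.aemeasurable (.of_forall fun z => ⟨ciInf_le hbdd z, by
          have : G z - c ≤ ⨅ z, G z := le_ciInf fun z' => by linarith [hGc z z']
          linarith⟩)).mgf_le t
      simpa [mgf, abs_of_nonneg hc0] using h
    have hexpB : ∀ x, |Real.exp (t * (F x - m))| ≤ Real.exp (|t| * (2 * B)) := by
      intro x
      rw [Real.abs_exp]
      refine Real.exp_le_exp.2 ((le_abs_self _).trans ?_)
      rw [abs_mul]
      refine mul_le_mul_of_nonneg_left ?_ (abs_nonneg t)
      have h1 := abs_le.1 (hB x)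
      have h2 := abs_le.1 hmB
      exact abs_le.2 ⟨by linarith [h1.1, h2.2], by linarith [h1.2, h2.1]⟩
    rw [hEF, integral_pi_succ (F := fun x => Real.exp (t * (F x - m))) (by fun_prop) hexpB]
    have hinner : ∀ z, ∫ y, Real.exp (t * (F (Fin.cons z y) - m)) ∂Pn ≤
        Real.exp (n * (c / 2) ^ 2 * t ^ 2 / 2) * Real.exp (t * (G z - m)) := by
      intro z
      have h := ih (fun y => F (Fin.cons z y)) (hFc.comp measurable_prodMk_left) (fun _ => hB _)
        (fun i y z' => by
          have := hc i.succ (Fin.cons z y) z'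
          rwa [← Fin.cons_update] at this)
      calc _ = (∫ y, Real.exp (t * (F (Fin.cons z y) - G z)) ∂Pn) * Real.exp (t * (G z - m)) := by
            rw [← integral_mul_const]
            refine integral_congr_ae (.of_forall fun y => ?_)
            simp only
            rw [← Real.exp_add]; ring_nf
        _ ≤ _ := mul_le_mul_of_nonneg_right h (Real.exp_pos _).le
    have hGint : Integrable (fun z => Real.exp (t * (G z - m))) P := by
      refine Integrable.of_bound (by fun_prop) (Real.exp (|t| * (2 * B))) (.of_forall fun z => ?_)
      rw [Real.norm_eq_abs, Real.abs_exp]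
      refine Real.exp_le_exp.2 ((le_abs_self _).trans ?_)
      rw [abs_mul]
      refine mul_le_mul_of_nonneg_left ?_ (abs_nonneg t)
      have h1 := abs_le.1 (hGB z)
      have h2 := abs_le.1 hmB
      exact abs_le.2 ⟨by linarith [h1.1, h2.2], by linarith [h1.2, h2.1]⟩
    calc _ ≤ ∫ z, Real.exp (n * (c / 2) ^ 2 * t ^ 2 / 2) * Real.exp (t * (G z - m)) ∂P :=
          integral_mono_of_nonneg (.of_forall fun z => integral_nonneg fun y => (Real.exp_pos _).le)
            (hGint.const_mul _) (.of_forall hinner)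
      _ = Real.exp (n * (c / 2) ^ 2 * t ^ 2 / 2) * ∫ z, Real.exp (t * (G z - m)) ∂P :=
          integral_const_mul _ _
      _ ≤ Real.exp (n * (c / 2) ^ 2 * t ^ 2 / 2) * Real.exp ((c / 2) ^ 2 * t ^ 2 / 2) :=
          mul_le_mul_of_nonneg_left hoeff (Real.exp_pos _).le
      _ = _ := by rw [← Real.exp_add]; push_cast; ring_nf

/-- **McDiarmid's inequality.** -/
theorem measureReal_pi_ge_le_of_bounded_differences (P : Measure Z) [IsProbabilityMeasure P]
    {c B : ℝ} {n : ℕ} (F : (Fin n → Z) → ℝ) (hF : Measurable F) (hB : ∀ x, |F x| ≤ B)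
    (hc0 : 0 ≤ c) (hc : ∀ i x z, |F (Function.update x i z) - F x| ≤ c) {ε : ℝ} (hε : 0 ≤ ε) :
    (Measure.pi fun _ : Fin n => P).real
      {x | ε ≤ F x - ∫ y, F y ∂(Measure.pi fun _ : Fin n => P)} ≤
        Real.exp (-ε ^ 2 / (2 * (n * (c / 2) ^ 2))) := by
  have h : HasSubgaussianMGF (fun x => F x - ∫ y, F y ∂(Measure.pi fun _ : Fin n => P))
      (n * (c.toNNReal / 2) ^ 2) (Measure.pi fun _ : Fin n => P) := by
    refine ⟨fun t => integrable_exp_mul_of_mem_Icc (a := -B - ∫ y, F y ∂(Measure.pi fun _ => P))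
      (b := B - ∫ y, F y ∂(Measure.pi fun _ => P)) (by fun_prop)
      (.of_forall fun x => ⟨by linarith [(abs_le.1 (hB x)).1], by linarith [(abs_le.1 (hB x)).2]⟩),
      fun t => ?_⟩
    have := integral_exp_sub_le_of_bounded_differences P t n F hF hB hc
    simpa [mgf, hc0] using this
  simpa [hc0] using h.measure_ge_le hε

variable {E : Type*} [NormedAddCommGroup E] [InnerProductSpace ℝ E] [CompleteSpace E]

/-- The variance of an average of `n` independent bounded vectors is `O(1 / n)`, since the mixed
terms of the squared norm vanish. -/
theorem integral_norm_average_sub_sq_le (P : Measure Z) [IsProbabilityMeasure P] {C : ℝ}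
    {ξ : Z → E} (hξ : StronglyMeasurable ξ) (hC : ∀ z, ‖ξ z‖ ≤ C) {n : ℕ} (hn : 1 ≤ n) :
    ∫ x, ‖(n : ℝ)⁻¹ • ∑ i, ξ (x i) - ∫ z, ξ z ∂P‖ ^ 2 ∂(Measure.pi fun _ : Fin n => P) ≤
      C ^ 2 / n := by
  have hn0 : (n : ℝ) ≠ 0 := by positivity
  set m := ∫ z, ξ z ∂P with hm
  have hξi : Integrable ξ P := .of_bound hξ.aestronglyMeasurable C (.of_forall hC)
  set η : Z → E := fun z => ξ z - m with hη
  have hηi : Integrable η P := hξi.sub (integrable_const m)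
  have hη0 : ∫ z, η z ∂P = 0 := by
    rw [hη, integral_sub hξi (integrable_const m)]; simp [hm]
  have hηm : StronglyMeasurable η := hξ.sub stronglyMeasurable_const
  have hmC : ‖m‖ ≤ C := by
    simpa using norm_integral_le_of_norm_le_const (μ := P) (.of_forall hC)
  have hηC : ∀ z, ‖η z‖ ≤ C + C := fun z =>
    (norm_sub_le _ _).trans (add_le_add (hC z) hmC)
  have hexp : ∀ x : Fin n → Z, ‖(n : ℝ)⁻¹ • ∑ i, ξ (x i) - m‖ ^ 2 =
      (n : ℝ)⁻¹ ^ 2 * ∑ i, ∑ j, inner ℝ (η (x i)) (η (x j)) := by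
    intro x
    have : (n : ℝ)⁻¹ • ∑ i, ξ (x i) - m = (n : ℝ)⁻¹ • ∑ i, η (x i) := by
      simp only [hη, Finset.sum_sub_distrib, Finset.sum_const, Finset.card_univ, Fintype.card_fin,
        smul_sub, ← Nat.cast_smul_eq_nsmul ℝ, smul_smul, inv_mul_cancel₀ hn0, one_smul]
    rw [this, norm_smul, mul_pow, ← real_inner_self_eq_norm_sq (∑ i, η (x i)), sum_inner]
    simp_rw [inner_sum]
    simp
  have hij : ∀ i j : Fin n, Integrable (fun x : Fin n → Z => inner ℝ (η (x i)) (η (x j)))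
      (Measure.pi fun _ : Fin n => P) := by
    intro i j
    refine Integrable.of_bound (((hηm.comp_measurable (measurable_pi_apply i)).inner
      (hηm.comp_measurable (measurable_pi_apply j))).aestronglyMeasurable) ((C + C) * (C + C))
      (.of_forall fun x => ?_)
    exact (norm_inner_le_norm _ _).trans
      (mul_le_mul (hηC _) (hηC _) (norm_nonneg _) ((norm_nonneg _).trans (hηC (x i))))
  have hval : ∀ i j : Fin n, ∫ x : Fin n → Z, inner ℝ (η (x i)) (η (x j))
      ∂(Measure.pi fun _ : Fin n => P) ≤ if i = j then C ^ 2 else 0 := by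
    intro i j
    have hmap : ∀ i : Fin n, (Measure.pi fun _ : Fin n => P).map (fun x => x i) = P :=
      fun i => (measurePreserving_eval (fun _ : Fin n => P) i).map_eq
    split_ifs with h
    · subst h
      have h1 : ∫ x : Fin n → Z, inner ℝ (η (x i)) (η (x i)) ∂(Measure.pi fun _ : Fin n => P)
          = ∫ z, ‖η z‖ ^ 2 ∂P := by
        simp_rw [real_inner_self_eq_norm_sq]
        have := integral_map (μ := Measure.pi fun _ : Fin n => P)
          (measurable_pi_apply i).aemeasurable (f := fun z => ‖η z‖ ^ 2)
          (hηm.norm.pow 2).aestronglyMeasurable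
        rw [← this, hmap i]
      rw [h1]
      have h2 : ∀ z, ‖η z‖ ^ 2 = ‖ξ z‖ ^ 2 - 2 * inner ℝ m (ξ z) + ‖m‖ ^ 2 := fun z => by
        rw [hη, norm_sub_sq_real, real_inner_comm]
      simp_rw [h2]
      have i1 : Integrable (fun z => ‖ξ z‖ ^ 2) P :=
        .of_bound (hξ.norm.pow 2).aestronglyMeasurable (C ^ 2) (.of_forall fun z => by
          rw [Real.norm_eq_abs, abs_of_nonneg (by positivity)]
          exact pow_le_pow_left₀ (norm_nonneg _) (hC z) 2)
      have i2 : Integrable (fun z => 2 * inner ℝ m (ξ z)) P := (hξi.const_inner m).const_mul 2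
      rw [integral_add (f := fun z => ‖ξ z‖ ^ 2 - 2 * inner ℝ m (ξ z)) (i1.sub i2)
          (integrable_const _), integral_sub i1 i2,
        integral_const_mul, integral_inner hξi, ← hm, real_inner_self_eq_norm_sq]
      have i3 : ∫ z, ‖ξ z‖ ^ 2 ∂P ≤ C ^ 2 :=
        (integral_mono i1 (integrable_const (C ^ 2)) fun z =>
          pow_le_pow_left₀ (norm_nonneg _) (hC z) 2).trans (by simp)
      simp only [integral_const, probReal_univ, one_smul]
      nlinarith [sq_nonneg ‖m‖]
    · have hind : IndepFun (fun x : Fin n → Z => x i) (fun x => x j)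
          (Measure.pi fun _ : Fin n => P) :=
        (iIndepFun_pi (μ := fun _ : Fin n => P) (X := fun _ => id)
          (fun _ => aemeasurable_id)).indepFun h
      have := hind.integral_bilin_comp_comp (f := η) (g := η) (measurable_pi_apply i).aemeasurable
        (measurable_pi_apply j).aemeasurable (by rw [hmap i]; exact hηi)
        (by rw [hmap j]; exact hηi) (innerSL ℝ)
      refine le_of_eq (this.trans ?_)
      have h0 : ∫ x : Fin n → Z, η (x i) ∂(Measure.pi fun _ : Fin n => P) = 0 := by
        have h0 := integral_map (μ := Measure.pi fun _ : Fin n => P)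
          (measurable_pi_apply i).aemeasurable (f := η) hηm.aestronglyMeasurable
        rw [← h0, hmap i, hη0]
      simp [h0]
  simp_rw [hexp]
  rw [integral_const_mul, integral_finsetSum _ fun i _ => integrable_finsetSum _ fun j _ => hij i j]
  calc _ ≤ (n : ℝ)⁻¹ ^ 2 * ∑ i : Fin n, ∑ j : Fin n, (if i = j then C ^ 2 else 0) := by
        refine mul_le_mul_of_nonneg_left (Finset.sum_le_sum fun i _ => ?_) (by positivity)
        rw [integral_finsetSum _ fun j _ => hij i j]
        exact Finset.sum_le_sum fun j _ => hval i j
    _ = C ^ 2 / n := by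
        simp
        field_simp

/-- Concentration of the average of independent vectors bounded everywhere. -/
theorem measureReal_pi_norm_average_sub_ge_le_of_forall (P : Measure Z) [IsProbabilityMeasure P]
    {C : ℝ} (hC0 : 0 < C) {ξ : Z → E} (hξ : StronglyMeasurable ξ) (hC : ∀ z, ‖ξ z‖ ≤ C) {n : ℕ}
    (hn : 1 ≤ n) {t : ℝ} (ht : 0 ≤ t) :
    (Measure.pi fun _ : Fin n => P).real
      {x | C / √n + t ≤ ‖(n : ℝ)⁻¹ • ∑ i, ξ (x i) - ∫ z, ξ z ∂P‖} ≤
        Real.exp (-(n * t ^ 2) / (2 * C ^ 2)) := by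
  have hn0 : (0 : ℝ) < n := by positivity
  set F : (Fin n → Z) → ℝ := fun x => ‖(n : ℝ)⁻¹ • ∑ i, ξ (x i) - ∫ z, ξ z ∂P‖ with hF
  have hmC : ‖∫ z, ξ z ∂P‖ ≤ C := by
    simpa using norm_integral_le_of_norm_le_const (μ := P) (.of_forall hC)
  have hsm : StronglyMeasurable fun x : Fin n → Z => ∑ i, ξ (x i) :=
    Finset.stronglyMeasurable_fun_sum _ fun i _ => hξ.comp_measurable (measurable_pi_apply i)
  have hFm : Measurable F :=
    ((hsm.const_smul (n : ℝ)⁻¹).sub stronglyMeasurable_const).norm.measurable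
  have hFB : ∀ x, |F x| ≤ C + C := by
    intro x
    rw [hF, abs_norm]
    refine (norm_sub_le _ _).trans (add_le_add ?_ hmC)
    rw [norm_smul, norm_inv, Real.norm_natCast]
    have : ‖∑ i, ξ (x i)‖ ≤ n * C := (norm_sum_le_of_le _ fun i _ => hC (x i)).trans (by simp)
    rw [inv_mul_le_iff₀ hn0]
    exact this
  have hFc : ∀ i x z, |F (Function.update x i z) - F x| ≤ 2 * C / n := by
    intro i x z
    have h1 : ∑ j, ξ (Function.update x i z j) = ∑ j, ξ (x j) + (ξ z - ξ (x i)) := by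
      rw [← sub_eq_iff_eq_add', ← Finset.sum_sub_distrib, Finset.sum_eq_single i]
      · simp
      · intro j _ hj; simp [hj]
      · simp
    refine (abs_norm_sub_norm_le _ _).trans ?_
    rw [h1, sub_sub_sub_cancel_right, ← smul_sub, add_sub_cancel_left, norm_smul, norm_inv,
      Real.norm_natCast, inv_mul_eq_div]
    gcongr
    linarith [norm_sub_le (ξ z) (ξ (x i)), hC z, hC (x i)]
  have hmean : ∫ y, F y ∂(Measure.pi fun _ : Fin n => P) ≤ C / √n := by
    have hL2 : MemLp F 2 (Measure.pi fun _ : Fin n => P) :=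
      MemLp.of_bound hFm.aestronglyMeasurable (C + C) (.of_forall hFB)
    have hv := variance_nonneg F (Measure.pi fun _ : Fin n => P)
    rw [variance_eq_sub hL2] at hv
    have h2 : ∫ x, F x ^ 2 ∂(Measure.pi fun _ : Fin n => P) ≤ C ^ 2 / n :=
      integral_norm_average_sub_sq_le P hξ hC hn
    refine abs_le_of_sq_le_sq' ?_ (by positivity) |>.2
    rw [div_pow, Real.sq_sqrt hn0.le]
    simp only [Pi.pow_apply] at hv
    linarith
  refine (measureReal_mono ?_).trans
    ((measureReal_pi_ge_le_of_bounded_differences P F hFm hFB (by positivity) hFc ht).trans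
      (le_of_eq ?_))
  · intro x hx
    simp only [mem_ofPred_eq] at hx ⊢
    linarith
  · congr 1
    field_simp

/-- Concentration of the average of `n` independent vectors of a Hilbert space, bounded by `C`
almost surely: the expected deviation is at most `C / √n` and McDiarmid's inequality controls the
fluctuations of the norm. -/
theorem measure_pi_norm_average_sub_ge_le (P : Measure Z) [IsProbabilityMeasure P]
    {C : ℝ} (hC0 : 0 < C) {ξ : Z → E} (hξ : StronglyMeasurable ξ) (hC : ∀ᵐ z ∂P, ‖ξ z‖ ≤ C) {n : ℕ}
    (hn : 1 ≤ n) {t : ℝ} (ht : 0 ≤ t) :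
    (Measure.pi fun _ : Fin n => P)
      {x | C / √n + t ≤ ‖(n : ℝ)⁻¹ • ∑ i, ξ (x i) - ∫ z, ξ z ∂P‖} ≤
        ENNReal.ofReal (Real.exp (-(n * t ^ 2) / (2 * C ^ 2))) := by
  set s : Set Z := {z | ‖ξ z‖ ≤ C} with hs
  have hsm : MeasurableSet s := measurableSet_le hξ.norm.measurable measurable_const
  have hae : s.indicator ξ =ᵐ[P] ξ := by
    filter_upwards [hC] with z hz
    exact indicator_of_mem (show z ∈ s from hz) ξ
  have hbd : ∀ z, ‖s.indicator ξ z‖ ≤ C := fun z => by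
    by_cases hz : z ∈ s
    · rw [indicator_of_mem hz]; exact hz
    · rw [indicator_of_notMem hz]; simpa using hC0.le
  have hpi : ∀ᵐ x ∂(Measure.pi fun _ : Fin n => P), ∀ i, s.indicator ξ (x i) = ξ (x i) :=
    ae_all_iff.2 fun i =>
      (measurePreserving_eval (fun _ : Fin n => P) i).quasiMeasurePreserving.ae hae
  have h := measureReal_pi_norm_average_sub_ge_le_of_forall P hC0 (hξ.indicator hsm) hbd hn ht
  rw [← ofReal_measureReal]
  refine ENNReal.ofReal_le_ofReal (le_trans (le_of_eq (measureReal_congr ?_)) h)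
  filter_upwards [hpi] with x hx
  rw [eq_iff_iff]
  change (_ ≤ _) ↔ (_ ≤ _)
  rw [integral_congr_ae hae]
  simp_rw [hx]

end Concentration

/-! ### The marginals of the trajectory and the policy value -/

section Dynamics

variable {S A : Type*} [MeasurableSpace S] [MeasurableSpace A]

/-- The mean reward `𝔼[R(s, a)]`. -/
noncomputable def MDP.meanReward (M : MDP S A) (u : S × A) : ℝ := ∫ r, r ∂(M.reward u)

theorem MDP.stronglyMeasurable_meanReward (M : MDP S A) : StronglyMeasurable M.meanReward :=
  stronglyMeasurable_id.integral_kernel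

theorem MDP.measurable_bellman (M : MDP S A) (π : Kernel S A) (γ : ℝ≥0) {f : S × A → ℝ} (hf : Measurable f) :
    Measurable (M.bellman π γ f) := by
  have h1 := M.stronglyMeasurable_meanReward.measurable
  have h2 := (hf.stronglyMeasurable.integral_kernel (κ := M.step π)).measurable
  exact h1.add (h2.const_mul _)

instance (M : MDP S A) (π : Kernel S A) [IsMarkovKernel π] :
    IsProbabilityMeasure (M.trajectory π) := by
  unfold MDP.trajectory; infer_instance

instance (M : MDP S A) (π : Kernel S A) [IsMarkovKernel π] (h : ℕ) :
    IsProbabilityMeasure (M.marginal π h) :=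
  Measure.isProbabilityMeasure_map (Measurable.aemeasurable (by fun_prop))

variable (M : MDP S A) (π : Kernel S A) [IsMarkovKernel π]

theorem MDP.map_trajectory_zero :
    (M.trajectory π).map (fun ω => ω 0) = M.start π ⊗ₘ M.reward := by
  have h : (fun ω : ℕ → (S × A) × ℝ => ω 0)
      = (fun x : Π _ : Finset.Iic 0, (S × A) × ℝ => x ⟨0, by simp⟩) ∘ Preorder.frestrictLe 0 := by
    ext ω <;> rfl
  rw [h, ← Measure.map_map (by fun_prop) (by fun_prop), MDP.trajectory, Kernel.trajMeasure,
    Measure.map_comp _ _ (by fun_prop), Kernel.traj_map_frestrictLe, Kernel.partialTraj_self,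
    Measure.id_comp, Measure.map_map (by fun_prop) (by fun_prop)]
  exact Measure.map_id

theorem MDP.marginal_zero : M.marginal π 0 = M.start π := by
  have h : (fun ω : ℕ → (S × A) × ℝ => (ω 0).1) = Prod.fst ∘ (fun ω => ω 0) := rfl
  rw [MDP.marginal, h, ← Measure.map_map (by fun_prop) (by fun_prop), M.map_trajectory_zero]
  exact Measure.fst_compProd _ _

theorem MDP.map_trajectory_succ (h : ℕ) :
    (M.trajectory π).map (fun ω => ω (h + 1)) =
      (M.step π ⊗ₖ Kernel.prodMkLeft (S × A) M.reward) ∘ₘ M.marginal π h := by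
  have h1 := Kernel.map_frestrictLe_trajMeasure_compProd_eq_map_trajMeasure
    (X := fun _ => (S × A) × ℝ) (μ₀ := M.start π ⊗ₘ M.reward) (κ := M.stepKernel π) (a := h)
  have h2 := congrArg Measure.snd h1
  rw [Measure.snd_compProd, Measure.snd, Measure.map_map (by fun_prop) (by fun_prop)] at h2
  refine Eq.trans h2.symm ?_
  have h3 : M.stepKernel π h = (M.step π ⊗ₖ Kernel.prodMkLeft (S × A) M.reward) ∘ₖ
      Kernel.deterministic (fun x : Π _ : Finset.Iic h, (S × A) × ℝ =>
        (x ⟨h, Finset.mem_Iic.2 le_rfl⟩).1) (by fun_prop) := by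
    rw [Kernel.comp_deterministic_eq_comap]; rfl
  rw [h3, ← Measure.comp_assoc, Measure.deterministic_comp_eq_map,
    Measure.map_map (by fun_prop) (by fun_prop)]
  rfl

theorem MDP.marginal_succ (h : ℕ) : M.marginal π (h + 1) = M.step π ∘ₘ M.marginal π h := by
  have h' : (fun ω : ℕ → (S × A) × ℝ => (ω (h + 1)).1) = Prod.fst ∘ (fun ω => ω (h + 1)) := rfl
  conv_lhs => rw [MDP.marginal, h', ← Measure.map_map (by fun_prop) (by fun_prop),
    M.map_trajectory_succ, Measure.map_comp _ _ (by fun_prop)]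
  congr 1
  rw [← Kernel.fst_eq, Kernel.fst_compProd]

/-- Given the state-action pair, the reward of the same time has the law prescribed by `R`. -/
theorem MDP.map_trajectory (h : ℕ) :
    (M.trajectory π).map (fun ω => ω h) = M.marginal π h ⊗ₘ M.reward := by
  cases h with
  | zero => rw [M.map_trajectory_zero, M.marginal_zero]
  | succ h =>
    rw [M.map_trajectory_succ, M.marginal_succ]
    ext s hs
    rw [Measure.bind_apply hs (Kernel.aemeasurable _), Measure.compProd_apply hs,
      Measure.lintegral_bind (Kernel.aemeasurable _)
        (Kernel.measurable_kernel_prodMk_left hs).aemeasurable]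
    refine lintegral_congr fun u => ?_
    rw [Kernel.compProd_apply hs]
    rfl

theorem MDP.ae_reward_mem (h : ℕ) : ∀ᵐ ω ∂(M.trajectory π), (ω h).2 ∈ Icc (0 : ℝ) 1 := by
  have h1 : ∀ᵐ p ∂(M.marginal π h ⊗ₘ M.reward), p.2 ∈ Icc (0 : ℝ) 1 :=
    (Measure.ae_compProd_iff (measurable_snd measurableSet_Icc)).2
      (.of_forall M.reward_mem)
  rw [← M.map_trajectory] at h1
  exact ae_of_ae_map (p := fun p : (S × A) × ℝ => p.2 ∈ Icc (0 : ℝ) 1)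
    (f := fun ω : ℕ → (S × A) × ℝ => ω h) (measurable_pi_apply h).aemeasurable h1

theorem MDP.integrable_reward (u : S × A) : Integrable (fun r => r) (M.reward u) :=
  Integrable.of_mem_Icc 0 1 aemeasurable_id (M.reward_mem u)

theorem MDP.meanReward_mem (u : S × A) : M.meanReward u ∈ Icc (0 : ℝ) 1 := by
  constructor
  · exact integral_nonneg_of_ae ((M.reward_mem u).mono fun r hr => hr.1)
  · refine (integral_mono_ae (M.integrable_reward u) (integrable_const 1)
      ((M.reward_mem u).mono fun r hr => hr.2)).trans (by simp)

theorem MDP.integral_reward (h : ℕ) :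
    ∫ ω, (ω h).2 ∂(M.trajectory π) = ∫ u, M.meanReward u ∂(M.marginal π h) := by
  have h1 : ∀ᵐ p ∂(M.marginal π h ⊗ₘ M.reward), p.2 ∈ Icc (0 : ℝ) 1 :=
    (Measure.ae_compProd_iff (measurable_snd measurableSet_Icc)).2
      (.of_forall M.reward_mem)
  have h2 : Integrable (fun p : (S × A) × ℝ => p.2) (M.marginal π h ⊗ₘ M.reward) :=
    Integrable.of_mem_Icc 0 1 (by fun_prop) h1
  have h3 := Measure.integral_compProd h2
  rw [← M.map_trajectory, integral_map (measurable_pi_apply h).aemeasurable (by fun_prop)] at h3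
  exact h3

theorem MDP.integral_marginal_succ (h : ℕ) {f : S × A → ℝ} (hf : Measurable f) {B : ℝ}
    (hB : ∀ u, |f u| ≤ B) :
    ∫ u, f u ∂(M.marginal π (h + 1)) = ∫ u, ∫ u', f u' ∂(M.step π u) ∂(M.marginal π h) := by
  have hi : Integrable (fun p : (S × A) × (S × A) => f p.2) (M.marginal π h ⊗ₘ M.step π) :=
    .of_bound (hf.comp measurable_snd).aestronglyMeasurable B (.of_forall fun _ => hB _)
  rw [M.marginal_succ, ← Measure.snd_compProd, Measure.snd,
    integral_map measurable_snd.aemeasurable hf.aestronglyMeasurable,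
    Measure.integral_compProd hi]

theorem MDP.hasSum_policyValue {γ : ℝ≥0} (hγ : γ < 1) :
    HasSum (fun h : ℕ => (γ : ℝ) ^ h * ∫ u, M.meanReward u ∂(M.marginal π h))
      (M.policyValue π γ) := by
  have hi : ∀ h : ℕ, Integrable (fun ω : ℕ → (S × A) × ℝ => (γ : ℝ) ^ h * (ω h).2)
      (M.trajectory π) := fun h =>
    (Integrable.of_mem_Icc 0 1 (measurable_pi_apply h).snd.aemeasurable
      (M.ae_reward_mem π h)).const_mul _
  have := hasSum_integral_of_summable_integral_norm hi (by
    refine Summable.of_nonneg_of_le (fun h => integral_nonneg fun ω => norm_nonneg _) (fun h => ?_)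
      (summable_geometric_of_lt_one γ.2 (by exact_mod_cast hγ))
    refine (integral_mono_ae (hi h).norm (integrable_const ((γ : ℝ) ^ h)) ?_).trans (by simp)
    filter_upwards [M.ae_reward_mem π h] with ω hω
    rw [norm_mul, Real.norm_of_nonneg (by positivity), Real.norm_of_nonneg hω.1]
    exact mul_le_of_le_one_right (by positivity) hω.2)
  simp_rw [integral_const_mul, M.integral_reward π] at this
  exact this

/-! ### The Bellman residual represents the error of the policy value -/

theorem MDP.isProbabilityMeasure_occupancy {γ : ℝ≥0} (hγ : γ < 1) :
    IsProbabilityMeasure (M.occupancy π γ) := by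
  refine ⟨?_⟩
  have h1 : ∑' h : ℕ, (γ ^ h • M.marginal π h) univ = ((1 - γ : ℝ≥0) : ℝ≥0∞)⁻¹ := by
    have : ∀ h : ℕ, (γ ^ h • M.marginal π h) univ = (γ : ℝ≥0∞) ^ h := fun h => by
      simp [Measure.smul_apply, ENNReal.smul_def]
    simp_rw [this]
    rw [ENNReal.tsum_geometric]
    push_cast
    rfl
  rw [MDP.occupancy, Measure.smul_apply, Measure.sum_apply _ MeasurableSet.univ, h1,
    ENNReal.smul_def, smul_eq_mul]
  refine ENNReal.mul_inv_cancel ?_ ENNReal.coe_ne_top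
  exact_mod_cast (tsub_pos_of_lt hγ).ne'

theorem MDP.occupancy_absolutelyContinuous (γ : ℝ≥0) {μ : Measure (S × A)}
    (hμ : ∀ h, M.marginal π h ≪ μ) : M.occupancy π γ ≪ μ := by
  refine Measure.AbsolutelyContinuous.smul_left
    (Measure.absolutelyContinuous_sum_left fun h => ?_) (1 - γ)
  exact (hμ h).smul_left (γ ^ h)

theorem MDP.hasSum_integral_occupancy {γ : ℝ≥0} (hγ : γ < 1) {g : S × A → ℝ} (hg : Measurable g)
    {B : ℝ} (hB : ∀ u, |g u| ≤ B) :
    HasSum (fun h : ℕ => (1 - γ : ℝ) * ((γ : ℝ) ^ h * ∫ u, g u ∂(M.marginal π h)))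
      (∫ u, g u ∂(M.occupancy π γ)) := by
  have := M.isProbabilityMeasure_occupancy π hγ
  have hc : (1 - γ : ℝ≥0) ≠ 0 := (tsub_pos_of_lt hγ).ne'
  have hint : Integrable g (M.occupancy π γ) :=
    .of_bound hg.aestronglyMeasurable B (.of_forall hB)
  have hint' : Integrable g (Measure.sum (fun h : ℕ => γ ^ h • M.marginal π h)) := by
    rw [MDP.occupancy] at hint
    exact (integrable_smul_measure (c := ((1 - γ : ℝ≥0) : ℝ≥0∞))
      (by exact_mod_cast hc) ENNReal.coe_ne_top).1 hint
  have h1 := (hasSum_integral_measure hint').mul_left (1 - γ : ℝ)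
  rw [MDP.occupancy, integral_smul_nnreal_measure, NNReal.smul_def, NNReal.coe_sub hγ.le,
    NNReal.coe_one, smul_eq_mul]
  simpa only [integral_smul_nnreal_measure, NNReal.smul_def, NNReal.coe_pow, smul_eq_mul] using h1

theorem coe_timeConst {γ : ℝ≥0} (hγ : γ < 1) : (timeConst γ : ℝ) = (1 - γ : ℝ)⁻¹ := by
  rw [timeConst, NNReal.coe_inv, NNReal.coe_sub hγ.le, NNReal.coe_one]

theorem one_add_mul_timeConst {γ : ℝ≥0} (hγ : γ < 1) :
    1 + (γ : ℝ) * timeConst γ = timeConst γ := by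
  have : (0 : ℝ) < 1 - γ := sub_pos.2 (by exact_mod_cast hγ)
  rw [coe_timeConst hγ]
  field_simp
  ring

theorem one_le_timeConst {γ : ℝ≥0} (hγ : γ < 1) : (1 : ℝ) ≤ timeConst γ := by
  rw [← one_add_mul_timeConst hγ]
  have : (0 : ℝ) ≤ γ * timeConst γ := by positivity
  linarith

theorem integral_mem_Icc {U : Type*} [MeasurableSpace U] {f : U → ℝ} (hfm : Measurable f) {C : ℝ}
    (hf : ∀ u, f u ∈ Icc 0 C) (μ : Measure U) [IsProbabilityMeasure μ] :
    ∫ u, f u ∂μ ∈ Icc 0 C :=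
  ⟨integral_nonneg fun u => (hf u).1,
    (integral_mono (Integrable.of_mem_Icc 0 C hfm.aemeasurable (.of_forall hf))
      (integrable_const _) fun u => (hf u).2).trans (by simp)⟩

theorem MDP.bellman_mem {γ : ℝ≥0} (hγ : γ < 1) {f : S × A → ℝ} (hfm : Measurable f)
    (hf : ∀ u, f u ∈ Icc (0 : ℝ) (timeConst γ)) (u : S × A) :
    M.bellman π γ f u ∈ Icc (0 : ℝ) (timeConst γ) := by
  have h1 := M.meanReward_mem u
  have h2 := integral_mem_Icc hfm hf (M.step π u)
  have h3 : (γ : ℝ) * ∫ u', f u' ∂(M.step π u) ≤ γ * timeConst γ :=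
    mul_le_mul_of_nonneg_left h2.2 γ.2
  have h4 : (0 : ℝ) ≤ (γ : ℝ) * ∫ u', f u' ∂(M.step π u) := mul_nonneg γ.2 h2.1
  have h5 := one_add_mul_timeConst hγ
  change M.meanReward u + _ ∈ _
  exact ⟨by linarith [h1.1], by linarith [h1.2]⟩

theorem MDP.abs_sub_bellman_le {γ : ℝ≥0} (hγ : γ < 1) {g f : S × A → ℝ} (hfm : Measurable f)
    (hg : ∀ u, g u ∈ Icc (0 : ℝ) (timeConst γ)) (hf : ∀ u, f u ∈ Icc (0 : ℝ) (timeConst γ))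
    (u : S × A) : |g u - M.bellman π γ f u| ≤ timeConst γ := by
  have h1 := hg u
  have h2 := M.bellman_mem π hγ hfm hf u
  exact abs_le.2 ⟨by linarith [h1.1, h2.2], by linarith [h1.2, h2.1]⟩

theorem MDP.integrable_sub_bellman {γ : ℝ≥0} (hγ : γ < 1) (μ : Measure (S × A))
    [IsFiniteMeasure μ] {g f : S × A → ℝ} (hgm : Measurable g) (hfm : Measurable f)
    (hg : ∀ u, g u ∈ Icc (0 : ℝ) (timeConst γ)) (hf : ∀ u, f u ∈ Icc (0 : ℝ) (timeConst γ)) :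
    Integrable (fun u => g u - M.bellman π γ f u) μ :=
  .of_bound (hgm.sub (M.measurable_bellman π γ hfm)).aestronglyMeasurable (timeConst γ)
    (.of_forall (M.abs_sub_bellman_le π hγ hfm hg hf))

/-- The error of `Q` is `C` times the mean of its Bellman residual under the discounted
occupancy: the expectations of `Q` along the trajectory telescope. -/
theorem MDP.opeError_eq_integral_occupancy {γ : ℝ≥0} (hγ : γ < 1) {Q : S × A → ℝ}
    (hQm : Measurable Q) (hQ : ∀ u, Q u ∈ Icc (0 : ℝ) (timeConst γ)) :
    M.opeError π γ Q =
      timeConst γ * ∫ u, (Q u - M.bellman π γ Q u) ∂(M.occupancy π γ) := by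
  have hγ' : (γ : ℝ) < 1 := by exact_mod_cast hγ
  have hpos : (0 : ℝ) < 1 - γ := sub_pos.2 hγ'
  have hQB : ∀ u, |Q u| ≤ timeConst γ := fun u => by
    rw [abs_of_nonneg (hQ u).1]; exact (hQ u).2
  set a : ℕ → ℝ := fun h => ∫ u, Q u ∂(M.marginal π h) with ha
  have ha_mem : ∀ h, a h ∈ Icc (0 : ℝ) (timeConst γ) := fun h => integral_mem_Icc hQm hQ _
  have hsum : Summable fun h : ℕ => (γ : ℝ) ^ h * a h := by
    refine Summable.of_nonneg_of_le
      (fun h => mul_nonneg (by positivity) (ha_mem h).1) (fun h => ?_)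
      ((summable_geometric_of_lt_one γ.2 hγ').mul_right (timeConst γ : ℝ))
    exact mul_le_mul_of_nonneg_left (ha_mem h).2 (by positivity)
  have hshift : HasSum (fun h : ℕ => (γ : ℝ) ^ (h + 1) * a (h + 1))
      ((∑' h : ℕ, (γ : ℝ) ^ h * a h) - a 0) := by
    simpa using (hasSum_nat_add_iff' 1).2 hsum.hasSum
  have hres : ∀ h, ∫ u, (Q u - M.bellman π γ Q u) ∂(M.marginal π h) =
      a h - ∫ u, M.meanReward u ∂(M.marginal π h) - γ * a (h + 1) := by
    intro h
    have i1 : Integrable M.meanReward (M.marginal π h) :=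
      Integrable.of_mem_Icc 0 1 M.stronglyMeasurable_meanReward.measurable.aemeasurable
        (.of_forall M.meanReward_mem)
    have i2 : Integrable (fun u => ∫ u', Q u' ∂(M.step π u)) (M.marginal π h) :=
      Integrable.of_mem_Icc 0 (timeConst γ)
        (hQm.stronglyMeasurable.integral_kernel (κ := M.step π)).measurable.aemeasurable
        (.of_forall fun u => integral_mem_Icc hQm hQ _)
    have i3 : Integrable Q (M.marginal π h) :=
      Integrable.of_mem_Icc 0 (timeConst γ) hQm.aemeasurable (.of_forall hQ)
    have e1 : ∫ u, (Q u - M.bellman π γ Q u) ∂(M.marginal π h) =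
        a h - ∫ u, M.bellman π γ Q u ∂(M.marginal π h) :=
      integral_sub i3 (i1.add (i2.const_mul _))
    have e2 : ∫ u, M.bellman π γ Q u ∂(M.marginal π h) =
        ∫ u, M.meanReward u ∂(M.marginal π h) +
          ∫ u, γ * ∫ u', Q u' ∂(M.step π u) ∂(M.marginal π h) :=
      integral_add i1 (i2.const_mul _)
    rw [e1, e2, integral_const_mul, ← M.integral_marginal_succ π h hQm hQB, sub_sub]
  have h1 := M.hasSum_integral_occupancy π hγ (hQm.sub (M.measurable_bellman π γ hQm))
    (M.abs_sub_bellman_le π hγ hQm hQ hQ)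
  have h2 := ((hsum.hasSum.sub (M.hasSum_policyValue π hγ)).sub hshift).mul_left (1 - γ : ℝ)
  have h3 := h1.unique (h2.congr_fun fun h => by simp only [Pi.sub_apply]; rw [hres]; ring)
  simp only [Pi.sub_apply] at h3
  rw [h3, coe_timeConst hγ, MDP.opeError, ← M.marginal_zero]
  change a 0 - _ = _
  field_simp
  ring

theorem MDP.opeError_eq_integral_weight {γ : ℝ≥0} (hγ : γ < 1) {μ : Measure (S × A)}
    [IsProbabilityMeasure μ] (hμ : ∀ h, M.marginal π h ≪ μ) {Q : S × A → ℝ}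
    (hQm : Measurable Q) (hQ : ∀ u, Q u ∈ Icc (0 : ℝ) (timeConst γ)) :
    M.opeError π γ Q =
      timeConst γ * ∫ u, M.weight π γ μ u * (Q u - M.bellman π γ Q u) ∂μ := by
  have := M.isProbabilityMeasure_occupancy π hγ
  rw [M.opeError_eq_integral_occupancy π hγ hQm hQ,
    ← integral_rnDeriv_smul (M.occupancy_absolutelyContinuous π γ hμ)]
  rfl

theorem MDP.integrable_weight {γ : ℝ≥0} (hγ : γ < 1) (μ : Measure (S × A)) :
    Integrable (M.weight π γ μ) μ :=
  have := M.isProbabilityMeasure_occupancy π hγ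
  Measure.integrable_toReal_rnDeriv

end Dynamics

/-! ### The feature map of the kernel and the dual norm -/

section RKHS

open RKHS

variable {U : Type*}

/-- The feature map `u ↦ κ(u, ·)` of a kernel into its reproducing kernel Hilbert space. -/
noncomputable def PDKernel.feature (κ : PDKernel U) (u : U) : κ.Space := kerFun κ.Space u 1

variable (κ : PDKernel U)

theorem PDKernel.inner_feature (u : U) (f : κ.Space) : inner ℝ (κ.feature u) f = f u := by
  rw [PDKernel.feature, kerFun_inner]
  simp

theorem PDKernel.inner_feature_feature (u v : U) :
    inner ℝ (κ.feature u) (κ.feature v) = κ.toFun u v := by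
  rw [κ.inner_feature, PDKernel.feature, kerFun_apply, κ.kernel_space]

variable {κ}

theorem PDKernel.norm_feature_le (hκ : ∀ u, |κ.toFun u u| ≤ 1) (u : U) : ‖κ.feature u‖ ≤ 1 := by
  have h := (abs_le.1 (hκ u)).2
  rw [← κ.inner_feature_feature, real_inner_self_eq_norm_sq] at h
  exact (sq_le_one_iff₀ (norm_nonneg _)).1 h

theorem PDKernel.abs_apply_le (hκ : ∀ u, |κ.toFun u u| ≤ 1) (f : κ.Space) (u : U) :
    |f u| ≤ ‖f‖ := by
  rw [← κ.inner_feature]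
  exact (abs_real_inner_le_norm _ _).trans
    (mul_le_of_le_one_left (norm_nonneg _) (κ.norm_feature_le hκ u))

section Topological

variable [TopologicalSpace U]

theorem PDKernel.continuous_feature
    (hκ : Continuous fun p : U × U => κ.toFun p.1 p.2) : Continuous κ.feature := by
  rw [continuous_iff_continuousAt]
  intro v
  have h : ∀ u, ‖κ.feature u - κ.feature v‖ =
      √(κ.toFun u u - 2 * κ.toFun u v + κ.toFun v v) := by
    intro u
    rw [← κ.inner_feature_feature u v, ← κ.inner_feature_feature u u,
      ← κ.inner_feature_feature v v, real_inner_self_eq_norm_sq, real_inner_self_eq_norm_sq,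
      ← norm_sub_sq_real, Real.sqrt_sq (norm_nonneg _)]
  have hd : Continuous fun u => κ.toFun u u :=
    hκ.comp (continuous_id.prodMk continuous_id)
  have hv : Continuous fun u => κ.toFun u v := hκ.comp (continuous_id.prodMk continuous_const)
  rw [ContinuousAt, tendsto_iff_norm_sub_tendsto_zero]
  simp_rw [h]
  have hc : Continuous fun u => √(κ.toFun u u - 2 * κ.toFun u v + κ.toFun v v) := by fun_prop
  have := hc.tendsto v
  rwa [show κ.toFun v v - 2 * κ.toFun v v + κ.toFun v v = 0 by ring, Real.sqrt_zero] at this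

variable [CompactSpace U] [MeasurableSpace U] [OpensMeasurableSpace U]

/-- The space `U` need not be separable, but its image under the feature map is a compact metric
space, which is enough for strong measurability. -/
theorem PDKernel.stronglyMeasurable_feature
    (hκ : Continuous fun p : U × U => κ.toFun p.1 p.2) : StronglyMeasurable κ.feature := by
  borelize κ.Space
  exact stronglyMeasurable_iff_measurable_separable.2
    ⟨(κ.continuous_feature hκ).measurable,
      (isCompact_range (κ.continuous_feature hκ)).isSeparable⟩

theorem PDKernel.measurable_coe
    (hκ : Continuous fun p : U × U => κ.toFun p.1 p.2) (f : κ.Space) : Measurable fun u => f u := by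
  simp_rw [← κ.inner_feature]
  exact ((κ.stronglyMeasurable_feature hκ).inner stronglyMeasurable_const).measurable

theorem PDKernel.integrable_coe (hκ : Continuous fun p : U × U => κ.toFun p.1 p.2)
    (hκ1 : ∀ u, |κ.toFun u u| ≤ 1) (μ : Measure U) [IsFiniteMeasure μ] (f : κ.Space) :
    Integrable (fun u => f u) μ :=
  .of_bound (κ.measurable_coe hκ f).aestronglyMeasurable ‖f‖ (.of_forall (κ.abs_apply_le hκ1 f))

theorem PDKernel.integrable_smul_feature (hκ : Continuous fun p : U × U => κ.toFun p.1 p.2)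
    (hκ1 : ∀ u, |κ.toFun u u| ≤ 1) {μ : Measure U} {g : U → ℝ} (hg : Integrable g μ) :
    Integrable (fun u => g u • κ.feature u) μ := by
  refine hg.norm.mono' (hg.aestronglyMeasurable.smul
    (κ.stronglyMeasurable_feature hκ).aestronglyMeasurable) (.of_forall fun u => ?_)
  rw [norm_smul]
  exact mul_le_of_le_one_right (norm_nonneg _) (κ.norm_feature_le hκ1 u)

theorem PDKernel.inner_integral_smul_feature (hκ : Continuous fun p : U × U => κ.toFun p.1 p.2)
    (hκ1 : ∀ u, |κ.toFun u u| ≤ 1) {μ : Measure U} {g : U → ℝ} (hg : Integrable g μ)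
    (f : κ.Space) : inner ℝ f (∫ u, g u • κ.feature u ∂μ) = ∫ u, f u * g u ∂μ := by
  rw [← integral_inner (κ.integrable_smul_feature hκ hκ1 hg)]
  refine integral_congr_ae (.of_forall fun u => ?_)
  simp only
  rw [real_inner_smul_right, real_inner_comm, κ.inner_feature, mul_comm]

/-- The dual norm of `g` is the norm of the mean embedding `∫ g(u) κ(u, ·) dμ(u)`. -/
theorem dualNorm_eq_norm_integral (hκ : Continuous fun p : U × U => κ.toFun p.1 p.2)
    (hκ1 : ∀ u, |κ.toFun u u| ≤ 1) {μ : Measure U} {g : U → ℝ} (hg : Integrable g μ) :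
    dualNorm κ μ g = ‖∫ u, g u • κ.feature u ∂μ‖ := by
  set m := ∫ u, g u • κ.feature u ∂μ with hm
  have hle : ∀ f : {f : κ.Space // ‖f‖ ≤ 1}, ∫ u, f.1 u * g u ∂μ ≤ ‖m‖ := by
    rintro ⟨f, hf⟩
    rw [← κ.inner_integral_smul_feature hκ hκ1 hg]
    exact (real_inner_le_norm _ _).trans (mul_le_of_le_one_left (norm_nonneg _) hf)
  have : Nonempty {f : κ.Space // ‖f‖ ≤ 1} := ⟨⟨0, by simp⟩⟩
  refine le_antisymm (ciSup_le hle) ?_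
  have hf : ‖(‖m‖⁻¹ • m : κ.Space)‖ ≤ 1 := by
    rw [norm_smul, norm_inv, norm_norm]
    exact inv_mul_le_one
  refine le_trans (le_of_eq ?_) (le_ciSup (f := fun f : {f : κ.Space // ‖f‖ ≤ 1} =>
    ∫ u, f.1 u * g u ∂μ) ⟨‖m‖, by rintro _ ⟨f, rfl⟩; exact hle f⟩ ⟨_, hf⟩)
  rw [← κ.inner_integral_smul_feature hκ hκ1 hg, ← hm, real_inner_smul_left,
    real_inner_self_eq_norm_sq]
  rcases eq_or_ne ‖m‖ 0 with h | h
  · simp [h]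
  · field_simp

theorem dualNorm_nonneg (κ : PDKernel U) (hκ : Continuous fun p : U × U => κ.toFun p.1 p.2)
    (hκ1 : ∀ u, |κ.toFun u u| ≤ 1) {μ : Measure U} {g : U → ℝ} (hg : Integrable g μ) :
    0 ≤ dualNorm κ μ g := by
  rw [dualNorm_eq_norm_integral hκ hκ1 hg]
  exact norm_nonneg _

theorem abs_integral_mul_le_norm_mul_dualNorm
    (hκ : Continuous fun p : U × U => κ.toFun p.1 p.2) (hκ1 : ∀ u, |κ.toFun u u| ≤ 1)
    {μ : Measure U} {g : U → ℝ} (hg : Integrable g μ) (f : κ.Space) :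
    |∫ u, f u * g u ∂μ| ≤ ‖f‖ * dualNorm κ μ g := by
  rw [dualNorm_eq_norm_integral hκ hκ1 hg, ← κ.inner_integral_smul_feature hκ hκ1 hg]
  exact abs_real_inner_le_norm _ _

theorem dualNorm_le (κ : PDKernel U) (hκ : Continuous fun p : U × U => κ.toFun p.1 p.2)
    (hκ1 : ∀ u, |κ.toFun u u| ≤ 1) {μ : Measure U} [IsProbabilityMeasure μ] {g : U → ℝ}
    (hg : Measurable g) {B : ℝ} (hB : ∀ u, |g u| ≤ B) : dualNorm κ μ g ≤ B := by
  have hgi : Integrable g μ := .of_bound hg.aestronglyMeasurable B (.of_forall hB)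
  rw [dualNorm_eq_norm_integral hκ hκ1 hgi]
  have h : ∀ u, ‖g u • κ.feature u‖ ≤ B := fun u => by
    rw [norm_smul]
    exact (mul_le_of_le_one_right (norm_nonneg _) (κ.norm_feature_le hκ1 u)).trans (hB u)
  simpa using norm_integral_le_of_norm_le_const (μ := μ) (.of_forall h)

end Topological

end RKHS

/-! ### The link function as an infimum of affine functions -/

section AffineInf

variable {ι : Type*} {a b : ι → ℝ} (ha : ∀ i, 0 ≤ a i) (hb : ∀ i, 0 ≤ b i)

include ha hb

theorem bddBelow_range_affine {y : ℝ} (hy : 0 ≤ y) : BddBelow (range fun i => a i + b i * y) :=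
  ⟨0, by rintro _ ⟨i, rfl⟩; exact add_nonneg (ha i) (mul_nonneg (hb i) hy)⟩

theorem iInf_affine_nonneg {y : ℝ} (hy : 0 ≤ y) : 0 ≤ ⨅ i, (a i + b i * y) :=
  Real.iInf_nonneg fun i => add_nonneg (ha i) (mul_nonneg (hb i) hy)

theorem iInf_affine_mono {y z : ℝ} (hy : 0 ≤ y) (hyz : y ≤ z) :
    ⨅ i, (a i + b i * y) ≤ ⨅ i, (a i + b i * z) :=
  ciInf_mono (bddBelow_range_affine ha hb hy) fun i =>
    add_le_add_right (mul_le_mul_of_nonneg_left hyz (hb i)) _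

variable [Nonempty ι]

/-- Subadditivity: of the affine functions that are nearly minimal at `y` and at `z`, the one of
smaller slope does at `y + z`. -/
theorem iInf_affine_add_le {y z : ℝ} (hy : 0 ≤ y) (hz : 0 ≤ z) :
    ⨅ i, (a i + b i * (y + z)) ≤ (⨅ i, (a i + b i * y)) + ⨅ i, (a i + b i * z) := by
  have hbd := bddBelow_range_affine ha hb (add_nonneg hy hz)
  rw [← sub_le_iff_le_add]
  refine le_ciInf fun i => ?_
  rw [sub_le_comm]
  refine le_ciInf fun j => ?_
  rw [sub_le_iff_le_add]
  rcases le_total (b i) (b j) with h | h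
  · refine (ciInf_le hbd i).trans ?_
    nlinarith [ha j, mul_le_mul_of_nonneg_right h hz]
  · refine (ciInf_le hbd j).trans ?_
    nlinarith [ha i, mul_le_mul_of_nonneg_right h hy]

theorem iInf_affine_concaveOn : ConcaveOn ℝ (Ici 0) fun y => ⨅ i, (a i + b i * y) := by
  refine ⟨convex_Ici 0, fun y hy z hz s t hs ht hst => le_ciInf fun i => ?_⟩
  have h1 := mul_le_mul_of_nonneg_left (ciInf_le (bddBelow_range_affine ha hb hy) i) hs
  have h2 := mul_le_mul_of_nonneg_left (ciInf_le (bddBelow_range_affine ha hb hz) i) ht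
  simp only [smul_eq_mul]
  have h3 : a i + b i * (s * y + t * z) = s * (a i + b i * y) + t * (a i + b i * z) := by
    linear_combination (-(a i)) * hst
  rw [h3]
  exact add_le_add h1 h2

/-- Upper semicontinuity from the right, inherited from the affine functions. -/
theorem exists_iInf_affine_add_le {y ε : ℝ} (hy : 0 ≤ y) (hε : 0 < ε) :
    ∃ δ > 0, ∀ z, 0 ≤ z → z ≤ δ → ⨅ i, (a i + b i * (y + z)) ≤ (⨅ i, (a i + b i * y)) + ε := by
  obtain ⟨i, hi⟩ := exists_lt_of_ciInf_lt (lt_add_of_pos_right (⨅ i, (a i + b i * y)) (half_pos hε))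
  have hbi : 0 < b i + 1 := by linarith [hb i]
  refine ⟨ε / 2 / (b i + 1), by positivity, fun z hz hzδ => ?_⟩
  refine (ciInf_le (bddBelow_range_affine ha hb (add_nonneg hy hz)) i).trans ?_
  rw [le_div_iff₀ hbi] at hzδ
  linarith

theorem iInf_affine_continuousOn (h0 : ⨅ i, (a i + b i * 0) = 0) :
    ContinuousOn (fun y => ⨅ i, (a i + b i * y)) (Ici 0) := by
  rw [Metric.continuousOn_iff]
  intro y hy ε hε
  obtain ⟨δ, hδ, h⟩ := exists_iInf_affine_add_le ha hb le_rfl (half_pos hε)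
  have key : ∀ u v : ℝ, 0 ≤ u → u ≤ v → v - u ≤ δ →
      |(⨅ i, (a i + b i * v)) - ⨅ i, (a i + b i * u)| < ε := by
    intro u v hu huv hδ'
    have h1 := iInf_affine_mono ha hb hu huv
    have h2 := iInf_affine_add_le ha hb hu (sub_nonneg.2 huv)
    have h3 := h (v - u) (sub_nonneg.2 huv) hδ'
    rw [h0, zero_add, zero_add] at h3
    rw [add_sub_cancel] at h2
    rw [abs_of_nonneg (sub_nonneg.2 h1)]
    linarith
  refine ⟨δ, hδ, fun z hz hzy => ?_⟩
  rw [Real.dist_eq] at hzy ⊢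
  rcases le_total y z with hyz | hyz
  · exact key y z hy hyz ((le_abs_self _).trans hzy.le)
  · rw [abs_sub_comm] at hzy ⊢
    exact key z y hz hyz ((le_abs_self _).trans hzy.le)

end AffineInf

section Link

theorem linkFun_slope_nonneg {U : Type*} {κ : PDKernel U} {C : ℝ≥0}
    (p : {p : ℝ × κ.Space // 0 < p.1 ∧ ‖p.2‖ ≤ p.1}) : 0 ≤ (C * p.1.1 : ℝ) :=
  mul_nonneg C.2 p.2.1.le

variable {U : Type*} [MeasurableSpace U] (κ : PDKernel U) (μ : Measure U) (C : ℝ≥0) (w : U → ℝ)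

/-- Radii `x > 0` together with an element of the closed ball of radius `x` of `F_κ`: the pairs
over which the two infima defining the link function run. -/
abbrev RadiusPair : Type _ := {p : ℝ × κ.Space // 0 < p.1 ∧ ‖p.2‖ ≤ p.1}

instance : Nonempty (RadiusPair κ) := ⟨⟨(1, 0), by simp⟩⟩

theorem linkFun_eq_iInf {y : ℝ} (hy : 0 ≤ y) :
    linkFun κ μ C w y =
      ⨅ p : RadiusPair κ, (C * (C * ∫ u, |w u - p.1.2 u| ∂μ) + C * p.1.1 * y) := by
  have hI : ∀ f : κ.Space, 0 ≤ ∫ u, |w u - f u| ∂μ := fun f =>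
    integral_nonneg fun u => abs_nonneg _
  have hx : Nonempty {x : ℝ // 0 < x} := ⟨⟨1, one_pos⟩⟩
  have hne : ∀ x : {x : ℝ // 0 < x}, Nonempty {f : κ.Space // ‖f‖ ≤ x.1} := fun x =>
    ⟨⟨0, by simpa using x.2.le⟩⟩
  have hbd : BddBelow (range fun p : RadiusPair κ =>
      (C * (C * ∫ u, |w u - p.1.2 u| ∂μ) + C * p.1.1 * y : ℝ)) :=
    bddBelow_range_affine (a := fun p : RadiusPair κ => (C * (C * ∫ u, |w u - p.1.2 u| ∂μ) : ℝ))
      (b := fun p => C * p.1.1)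
      (fun p => mul_nonneg C.2 (mul_nonneg C.2 (hI _))) (fun p => mul_nonneg C.2 p.2.1.le) hy
  rw [linkFun, Real.mul_iInf_of_nonneg C.coe_nonneg]
  refine le_antisymm (le_ciInf fun p => ?_) (le_ciInf fun x => ?_)
  · refine (ciInf_le ⟨0, ?_⟩ ⟨p.1.1, p.2.1⟩).trans ?_
    · rintro _ ⟨x, rfl⟩
      exact mul_nonneg C.2 (add_nonneg (mul_nonneg C.2 (Real.iInf_nonneg fun f => hI _))
        (mul_nonneg x.2.le hy))
    · rw [mul_add, mul_assoc (C : ℝ) p.1.1 y]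
      refine add_le_add_left (mul_le_mul_of_nonneg_left
        (mul_le_mul_of_nonneg_left ?_ C.2) C.2) _
      exact ciInf_le (f := fun f : {f : κ.Space // ‖f‖ ≤ p.1.1} => ∫ u, |w u - f.1 u| ∂μ)
        ⟨0, by rintro _ ⟨f, rfl⟩; exact hI _⟩ ⟨p.1.2, p.2.2⟩
  · have := hne x
    rw [mul_add, ← mul_assoc (C : ℝ) x.1 y, ← sub_le_iff_le_add, Real.mul_iInf_of_nonneg C.coe_nonneg,
      Real.mul_iInf_of_nonneg C.coe_nonneg]
    refine le_ciInf fun f => ?_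
    rw [sub_le_iff_le_add]
    exact ciInf_le hbd ⟨(x.1, f.1), x.2, f.2⟩

variable {κ μ C w}

theorem linkFun_coeff_nonneg (p : RadiusPair κ) : 0 ≤ (C * (C * ∫ u, |w u - p.1.2 u| ∂μ) : ℝ) :=
  mul_nonneg C.2 (mul_nonneg C.2 (integral_nonneg fun _ => abs_nonneg _))

theorem linkFun_nonneg {y : ℝ} (hy : 0 ≤ y) : 0 ≤ linkFun κ μ C w y := by
  rw [linkFun_eq_iInf κ μ C w hy]
  exact iInf_affine_nonneg linkFun_coeff_nonneg linkFun_slope_nonneg hy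

theorem linkFun_mono {y z : ℝ} (hy : 0 ≤ y) (hyz : y ≤ z) :
    linkFun κ μ C w y ≤ linkFun κ μ C w z := by
  rw [linkFun_eq_iInf κ μ C w hy, linkFun_eq_iInf κ μ C w (hy.trans hyz)]
  exact iInf_affine_mono linkFun_coeff_nonneg linkFun_slope_nonneg hy hyz

theorem linkFun_add_le {y z : ℝ} (hy : 0 ≤ y) (hz : 0 ≤ z) :
    linkFun κ μ C w (y + z) ≤ linkFun κ μ C w y + linkFun κ μ C w z := by
  rw [linkFun_eq_iInf κ μ C w hy, linkFun_eq_iInf κ μ C w hz,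
    linkFun_eq_iInf κ μ C w (add_nonneg hy hz)]
  exact iInf_affine_add_le linkFun_coeff_nonneg linkFun_slope_nonneg hy hz

theorem exists_linkFun_add_le (κ : PDKernel U) (μ : Measure U) (C : ℝ≥0) (w : U → ℝ) {y ε : ℝ}
    (hy : 0 ≤ y) (hε : 0 < ε) :
    ∃ δ > 0, ∀ z, 0 ≤ z → z ≤ δ → linkFun κ μ C w (y + z) ≤ linkFun κ μ C w y + ε := by
  obtain ⟨δ, hδ, h⟩ := exists_iInf_affine_add_le
    (a := fun p : RadiusPair κ => (C * (C * ∫ u, |w u - p.1.2 u| ∂μ) : ℝ))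
    linkFun_coeff_nonneg linkFun_slope_nonneg hy hε
  refine ⟨δ, hδ, fun z hz hzδ => ?_⟩
  rw [linkFun_eq_iInf κ μ C w hy, linkFun_eq_iInf κ μ C w (add_nonneg hy hz)]
  exact h z hz hzδ

/-- If `w` agrees almost everywhere with an element of `F_κ`, the approximation term vanishes. -/
theorem linkFun_le_of_ae_eq {y : ℝ} (hy : 0 ≤ y) {f : κ.Space} (hf : (fun u => f u) =ᵐ[μ] w) :
    linkFun κ μ C w y ≤ C * y * ‖f‖ := by
  refine le_of_forall_pos_le_add fun ε hε => ?_
  have hc : (0 : ℝ) < C * y + 1 := by positivity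
  have hx : 0 < ‖f‖ + ε / (C * y + 1) := by positivity
  rw [linkFun_eq_iInf κ μ C w hy]
  refine (ciInf_le (bddBelow_range_affine linkFun_coeff_nonneg linkFun_slope_nonneg hy)
    (⟨(‖f‖ + ε / (C * y + 1), f), hx, by simp only; linarith [div_pos hε hc]⟩ :
      RadiusPair κ)).trans ?_
  have h0 : ∫ u, |w u - f u| ∂μ = 0 := by
    rw [integral_eq_zero_of_ae]
    filter_upwards [hf] with u hu
    simp [← hu]
  simp only
  rw [h0]
  have : C * y * (ε / (C * y + 1)) ≤ ε := by
    rw [mul_div_assoc', div_le_iff₀ hc]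
    nlinarith [mul_nonneg C.2 hy]
  nlinarith

/-- The linear bound `φ(y) ≤ C ‖w‖ y`. -/
theorem ofReal_linkFun_le (hC : 0 < C) {y : ℝ} (hy : 0 < y) :
    ENNReal.ofReal (linkFun κ μ C w y) ≤ ENNReal.ofReal (C * y) * spaceENorm κ μ w := by
  have hc : ENNReal.ofReal (C * y) ≠ 0 := by
    rw [Ne, ENNReal.ofReal_eq_zero, not_le]
    exact mul_pos (by exact_mod_cast hC) hy
  rw [spaceENorm, ENNReal.mul_iInf_of_ne hc ENNReal.ofReal_ne_top]
  refine le_iInf fun f => ?_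
  rw [ENNReal.mul_iInf_of_ne hc ENNReal.ofReal_ne_top]
  refine le_iInf fun hf => ?_
  rw [← ofReal_norm, ← ENNReal.ofReal_mul (by positivity)]
  exact ENNReal.ofReal_le_ofReal (linkFun_le_of_ae_eq hy.le hf)

theorem linkFun_zero (hd : DenseInL1 κ μ) (hw : Integrable w μ) : linkFun κ μ C w 0 = 0 := by
  refine le_antisymm (le_of_forall_pos_le_add fun ε hε => ?_) (linkFun_nonneg le_rfl)
  have hc : (0 : ℝ) < C * C + 1 := by positivity
  obtain ⟨f, hf⟩ := hd w hw (ε / (C * C + 1)) (by positivity)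
  rw [linkFun_eq_iInf κ μ C w le_rfl]
  refine (ciInf_le (bddBelow_range_affine linkFun_coeff_nonneg linkFun_slope_nonneg le_rfl)
    (⟨(‖f‖ + 1, f), by positivity, by simp⟩ : RadiusPair κ)).trans ?_
  rw [lt_div_iff₀ hc] at hf
  have h0 : 0 ≤ ∫ u, |w u - f u| ∂μ := integral_nonneg fun u => abs_nonneg _
  simp only
  nlinarith

theorem isLinkFunction_linkFun (hd : DenseInL1 κ μ) (hw : Integrable w μ) :
    IsLinkFunction (linkFun κ μ C w) := by
  have h0 := linkFun_zero (C := C) hd hw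
  have heq : EqOn (linkFun κ μ C w) (fun y => ⨅ p : RadiusPair κ,
      (C * (C * ∫ u, |w u - p.1.2 u| ∂μ) + C * p.1.1 * y)) (Ici 0) :=
    fun y hy => linkFun_eq_iInf κ μ C w hy
  refine ⟨fun y hy => linkFun_nonneg hy, fun y hy z _ hyz => linkFun_mono hy hyz, ?_, ?_, h0⟩
  · refine (iInf_affine_continuousOn linkFun_coeff_nonneg linkFun_slope_nonneg ?_).congr heq
    rw [← linkFun_eq_iInf κ μ C w le_rfl, h0]
  · exact (iInf_affine_concaveOn linkFun_coeff_nonneg linkFun_slope_nonneg).congr heq.symm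

end Link

/-! ### The master error bound -/

section Master

variable {S A : Type*} [TopologicalSpace S] [TopologicalSpace A]
  [MeasurableSpace S] [MeasurableSpace A] [CompactSpace (S × A)] [OpensMeasurableSpace (S × A)]

/-- Splitting the density `w` into `f ∈ F_κ` and `w - f`, the first part pairs with the Bellman
residual through the dual norm and the second through the bound `C` on the residual. -/
theorem abs_opeError_le_klmLink (M : MDP S A) (π : Kernel S A) [IsMarkovKernel π] {γ : ℝ≥0}
    (hγ : γ < 1) {μ : Measure (S × A)} [IsProbabilityMeasure μ] (hμ : ∀ h, M.marginal π h ≪ μ)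
    {κ : PDKernel (S × A)} (hκ : Continuous fun p : (S × A) × (S × A) => κ.toFun p.1 p.2)
    (hκ1 : ∀ u, |κ.toFun u u| ≤ 1) {Q : S × A → ℝ} (hQm : Measurable Q)
    (hQ : ∀ u, Q u ∈ Icc (0 : ℝ) (timeConst γ)) :
    |M.opeError π γ Q| ≤
      klmLink M π γ μ κ (dualNorm κ μ fun u => Q u - M.bellman π γ Q u) := by
  set C := timeConst γ with hC
  set g : S × A → ℝ := fun u => Q u - M.bellman π γ Q u with hg
  set w := M.weight π γ μ with hw
  have hgm : Measurable g := hQm.sub (M.measurable_bellman π γ hQm)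
  have hgB : ∀ u, |g u| ≤ C := M.abs_sub_bellman_le π hγ hQm hQ hQ
  have hgi : Integrable g μ := .of_bound hgm.aestronglyMeasurable C (.of_forall hgB)
  have hwi : Integrable w μ := M.integrable_weight π hγ μ
  have hd := dualNorm_nonneg κ hκ hκ1 hgi
  rw [M.opeError_eq_integral_weight π hγ hμ hQm hQ, klmLink, linkFun_eq_iInf _ _ _ _ hd]
  refine le_ciInf fun p => ?_
  obtain ⟨⟨x, f⟩, hx, hfx⟩ := p
  have hfi := κ.integrable_coe hκ hκ1 μ f
  have i1 : Integrable (fun u => (w u - f u) * g u) μ :=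
    (hwi.sub hfi).mul_bdd (c := C) hgm.aestronglyMeasurable (.of_forall hgB)
  have i2 : Integrable (fun u => f u * g u) μ :=
    hfi.mul_bdd (c := C) hgm.aestronglyMeasurable (.of_forall hgB)
  have hsplit : ∫ u, w u * g u ∂μ = ∫ u, (w u - f u) * g u ∂μ + ∫ u, f u * g u ∂μ := by
    rw [← integral_add i1 i2]
    refine integral_congr_ae (.of_forall fun u => ?_)
    simp only
    ring
  have h1 : |∫ u, (w u - f u) * g u ∂μ| ≤ C * ∫ u, |w u - f u| ∂μ := by
    rw [← integral_const_mul]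
    refine (abs_integral_le_integral_abs).trans
      (integral_mono i1.abs ((hwi.sub hfi).abs.const_mul _) fun u => ?_)
    simp only [abs_mul]
    rw [mul_comm]
    exact mul_le_mul_of_nonneg_right (hgB u) (abs_nonneg _)
  have h2 : |∫ u, f u * g u ∂μ| ≤ x * dualNorm κ μ g :=
    (abs_integral_mul_le_norm_mul_dualNorm hκ hκ1 hgi f).trans
      (mul_le_mul_of_nonneg_right hfx hd)
  change |(C : ℝ) * ∫ u, w u * g u ∂μ| ≤ _
  rw [hsplit, abs_mul, NNReal.abs_eq, mul_assoc (C : ℝ) x, ← mul_add]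
  exact mul_le_mul_of_nonneg_left ((abs_add_le _ _).trans (add_le_add h1 h2)) C.2

end Master

/-! ### The Bellman residual of the averaged iterates -/

section Residual

variable {U : Type*} [MeasurableSpace U] {C : ℝ≥0}

theorem measurable_qBar (X : Operator U C) (h : ℕ) : Measurable (qBar X h) := by
  induction h with
  | zero => exact measurable_const
  | succ h ih =>
    rw [qBar]
    split_ifs
    · exact (qIter X (h + 1)).2.1
    · exact (ih.const_mul _).add ((qIter X (h + 1)).2.1.const_mul _)

theorem qBar_mem (X : Operator U C) (h : ℕ) (u : U) : qBar X h u ∈ Icc (0 : ℝ) C := by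
  induction h with
  | zero => exact ⟨le_rfl, C.2⟩
  | succ h ih =>
    rw [qBar]
    split_ifs
    · exact (qIter X (h + 1)).2.2 u
    · have h0 : (0 : ℝ) ≤ 1 / ((h : ℝ) + 1) := by positivity
      have h1 : 1 / ((h : ℝ) + 1) ≤ 1 := by
        rw [div_le_one (by positivity)]
        linarith [Nat.cast_nonneg (α := ℝ) h]
      exact convex_Icc (0 : ℝ) (C : ℝ) ih ((qIter X (h + 1)).2.2 u) (sub_nonneg.2 h1) h0
        (by ring)

theorem qIter_succ_eq_of_eq {X : Operator U C} {h : ℕ} (hX : qIter X (h + 1) = qIter X h) :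
    qIter X (h + 2) = qIter X (h + 1) :=
  congrArg X hX

/-- As long as no fixed point has been met, `qBar` is the average of the iterates. -/
theorem qBar_eq_sum {X : Operator U C} (h : ℕ) (hX : qIter X (h + 1) ≠ qIter X h) (u : U) :
    ((h : ℝ) + 1) * qBar X (h + 1) u = ∑ k ∈ Finset.range (h + 1), (qIter X (k + 1)).1 u := by
  have hrec : ∀ h : ℕ, qIter X (h + 1) ≠ qIter X h →
      ((h : ℝ) + 1) * qBar X (h + 1) u = h * qBar X h u + (qIter X (h + 1)).1 u := by
    intro h hX
    have h0 : (h : ℝ) + 1 ≠ 0 := by positivity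
    rw [qBar, if_neg hX]
    field_simp
    ring
  induction h with
  | zero => rw [hrec 0 hX]; simp
  | succ h ih =>
    rw [hrec (h + 1) hX, Finset.sum_range_succ, ← ih fun h' => hX (qIter_succ_eq_of_eq h')]
    push_cast
    ring

variable [TopologicalSpace U] [CompactSpace U] [OpensMeasurableSpace U]

theorem dualNorm_average_le {κ : PDKernel U} (hκ : Continuous fun p : U × U => κ.toFun p.1 p.2)
    (hκ1 : ∀ u, |κ.toFun u u| ≤ 1) {μ : Measure U} {N : ℕ} (hN : 1 ≤ N) {g r : U → ℝ}
    {g' : ℕ → U → ℝ} (hg : Integrable g μ) (hr : Integrable r μ) (hg' : ∀ k, Integrable (g' k) μ)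
    (heq : ∀ u, (N : ℝ) * g u = ∑ k ∈ Finset.range N, g' k u + r u) {a b : ℝ}
    (ha : ∀ k, dualNorm κ μ (g' k) ≤ a) (hb : dualNorm κ μ r ≤ b) :
    dualNorm κ μ g ≤ a + b / N := by
  have hN0 : (0 : ℝ) < N := by exact_mod_cast hN
  have h1 : (N : ℝ) • ∫ u, g u • κ.feature u ∂μ =
      ∑ k ∈ Finset.range N, ∫ u, g' k u • κ.feature u ∂μ + ∫ u, r u • κ.feature u ∂μ := by
    rw [← integral_smul, ← integral_finsetSum _ fun k _ => κ.integrable_smul_feature hκ hκ1 (hg' k),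
      ← integral_add (integrable_finsetSum _ fun k _ => κ.integrable_smul_feature hκ hκ1 (hg' k))
        (κ.integrable_smul_feature hκ hκ1 hr)]
    refine integral_congr_ae (.of_forall fun u => ?_)
    simp only
    rw [← Finset.sum_smul, ← add_smul, ← heq, mul_smul]
  have h2 : (N : ℝ) * dualNorm κ μ g ≤ N * a + b := by
    rw [dualNorm_eq_norm_integral hκ hκ1 hg, ← Real.norm_natCast N, ← norm_smul, h1,
      Real.norm_natCast]
    refine (norm_add_le _ _).trans (add_le_add ?_ ?_)
    · refine (norm_sum_le_of_le _ fun k _ => ?_).trans_eq (b := ∑ k ∈ Finset.range N, a) (by simp)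
      rw [← dualNorm_eq_norm_integral hκ hκ1 (hg' k)]
      exact ha k
    · rwa [← dualNorm_eq_norm_integral hκ hκ1 hr]
  rw [← mul_le_mul_iff_of_pos_left hN0]
  refine h2.trans_eq ?_
  field_simp

end Residual

section Bellman

variable {S A : Type*} [TopologicalSpace S] [TopologicalSpace A]
  [MeasurableSpace S] [MeasurableSpace A] [CompactSpace (S × A)] [OpensMeasurableSpace (S × A)]
  (M : MDP S A) (π : Kernel S A) [IsMarkovKernel π] {γ : ℝ≥0} (hγ : γ < 1)
  (μ : Measure (S × A)) [IsProbabilityMeasure μ]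
  {κ : PDKernel (S × A)} (hκ : Continuous fun p : (S × A) × (S × A) => κ.toFun p.1 p.2)
  (hκ1 : ∀ u, |κ.toFun u u| ≤ 1)

include hγ hκ hκ1

theorem bellmanErrorNorm_nonneg (X : Operator (S × A) (timeConst γ)) :
    0 ≤ bellmanErrorNorm M π γ μ κ X :=
  Real.iSup_nonneg fun f => dualNorm_nonneg κ hκ hκ1
    (M.integrable_sub_bellman π hγ μ (X f).2.1 f.2.1 (X f).2.2 f.2.2)

theorem dualNorm_le_bellmanErrorNorm (X : Operator (S × A) (timeConst γ))
    (f : BFun (S × A) (timeConst γ)) :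
    dualNorm κ μ (fun u => (X f).1 u - M.bellman π γ f.1 u) ≤ bellmanErrorNorm M π γ μ κ X :=
  le_ciSup (f := fun f : BFun (S × A) (timeConst γ) =>
      dualNorm κ μ (fun u => (X f).1 u - M.bellman π γ f.1 u))
    ⟨timeConst γ, by
      rintro _ ⟨f, rfl⟩
      exact dualNorm_le κ hκ hκ1 ((X f).2.1.sub (M.measurable_bellman π γ f.2.1))
        (M.abs_sub_bellman_le π hγ f.2.1 (X f).2.2 f.2.2)⟩ f

/-- The residual of the output is that of the operator up to `C / H`: at a fixed point it is a
value of `ΔX`, and otherwise the residuals of the averaged iterates telescope, because the Bellman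
operator is affine. -/
theorem dualNorm_qBar_sub_bellman_le (X : Operator (S × A) (timeConst γ)) {H : ℕ} (hH : 1 ≤ H) :
    dualNorm κ μ (fun u => qBar X H u - M.bellman π γ (qBar X H) u) ≤
      bellmanErrorNorm M π γ μ κ X + timeConst γ / H := by
  obtain ⟨h, rfl⟩ := Nat.exists_eq_add_of_le' hH
  by_cases hX : qIter X (h + 1) = qIter X h
  · have hq : qBar X (h + 1) = (qIter X (h + 1)).1 := by rw [qBar, if_pos hX]
    have h1 := dualNorm_le_bellmanErrorNorm M π hγ μ hκ hκ1 X (qIter X (h + 1))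
    have h2 : X (qIter X (h + 1)) = qIter X (h + 1) := congrArg X hX
    rw [h2] at h1
    rw [hq]
    have : (0 : ℝ) ≤ timeConst γ / ((h + 1 : ℕ) : ℝ) := by positivity
    linarith
  set N : ℕ := h + 1 with hN
  have hsum : ∀ u, (N : ℝ) * qBar X N u = ∑ k ∈ Finset.range N, (qIter X (k + 1)).1 u := by
    intro u
    rw [← qBar_eq_sum h hX u, hN]
    push_cast
    rfl
  have hN0 : (N : ℝ) ≠ 0 := by positivity
  have hB : ∀ u, (N : ℝ) * M.bellman π γ (qBar X N) u =
      ∑ k ∈ Finset.range N, M.bellman π γ (qIter X (k + 1)).1 u := by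
    intro u
    have hint : ∀ k, Integrable (qIter X k).1 (M.step π u) := fun k =>
      Integrable.of_mem_Icc 0 (timeConst γ) (qIter X k).2.1.aemeasurable
        (.of_forall (qIter X k).2.2)
    have h1 : (N : ℝ) * ∫ u', qBar X N u' ∂(M.step π u) =
        ∑ k ∈ Finset.range N, ∫ u', (qIter X (k + 1)).1 u' ∂(M.step π u) := by
      rw [← integral_finsetSum _ fun k _ => hint (k + 1), ← integral_const_mul]
      simp_rw [hsum]
    have h2 : (N : ℝ) * M.bellman π γ (qBar X N) u = N * M.meanReward u +
        γ * (N * ∫ u', qBar X N u' ∂(M.step π u)) := by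
      change (N : ℝ) * (M.meanReward u + _) = _
      ring
    rw [h2, h1, Finset.mul_sum]
    change _ = ∑ k ∈ Finset.range N, (M.meanReward u + _)
    rw [Finset.sum_add_distrib]
    simp
  refine dualNorm_average_le hκ hκ1 hH
    (g' := fun k u => (X (qIter X k)).1 u - M.bellman π γ (qIter X k).1 u)
    (r := fun u => M.bellman π γ (qIter X 0).1 u - M.bellman π γ (qIter X N).1 u)
    (M.integrable_sub_bellman π hγ μ (measurable_qBar X N) (measurable_qBar X N) (qBar_mem X N)
      (qBar_mem X N)) ?_
    (fun k => M.integrable_sub_bellman π hγ μ (X _).2.1 (qIter X k).2.1 (X _).2.2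
      (qIter X k).2.2) (fun u => ?_)
    (fun k => dualNorm_le_bellmanErrorNorm M π hγ μ hκ hκ1 X (qIter X k)) ?_
  · exact M.integrable_sub_bellman π hγ μ (M.measurable_bellman π γ (qIter X 0).2.1)
      (qIter X N).2.1 (M.bellman_mem π hγ (qIter X 0).2.1 (qIter X 0).2.2) (qIter X N).2.2
  · have h3 := Finset.sum_range_sub' (fun k => M.bellman π γ (qIter X k).1 u) N
    rw [mul_sub, hsum, hB, ← h3, ← Finset.sum_sub_distrib, ← Finset.sum_add_distrib]
    refine Finset.sum_congr rfl fun k _ => ?_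
    change _ = (qIter X (k + 1)).1 u - _ + _
    ring
  · exact dualNorm_le κ hκ hκ1
      ((M.measurable_bellman π γ (qIter X 0).2.1).sub (M.measurable_bellman π γ (qIter X N).2.1))
      (M.abs_sub_bellman_le π hγ (qIter X N).2.1
        (M.bellman_mem π hγ (qIter X 0).2.1 (qIter X 0).2.2) (qIter X N).2.2)

end Bellman

/-! ### The kernel Bellman loss as the norm of an average -/

section Loss

variable {U : Type*}

/-- The temporal difference of `f` at a data tuple `(u, r, u')`, embedded in `F_κ` by the feature
of `u`. -/
noncomputable def embeddedTD (κ : PDKernel U) (γ : ℝ≥0) (f : U → ℝ) (z : U × ℝ × U) : κ.Space :=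
  (z.2.1 + γ * f z.2.2 - f z.1) • κ.feature z.1

theorem fixedPointLoss_eq (κ : PDKernel U) (γ : ℝ≥0) {n : ℕ} (D : Fin n → U × ℝ × U)
    (f : U → ℝ) :
    fixedPointLoss κ γ D f = ‖(n : ℝ)⁻¹ • ∑ i, embeddedTD κ γ f (D i)‖ ^ 2 := by
  rw [fixedPointLoss, kernelBellmanLoss, norm_smul, mul_pow,
    ← real_inner_self_eq_norm_sq (∑ i, embeddedTD κ γ f (D i)), sum_inner]
  simp_rw [inner_sum, embeddedTD, real_inner_smul_left, real_inner_smul_right,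
    κ.inner_feature_feature]
  simp only [id, norm_inv, Real.norm_natCast, inv_pow, one_div]
  congr 1
  exact Finset.sum_congr rfl fun i _ => Finset.sum_congr rfl fun j _ => by ring

end Loss

section Data

variable {S A : Type*} [MeasurableSpace S] [MeasurableSpace A]
  (M : MDP S A) (π : Kernel S A) [IsMarkovKernel π] {γ : ℝ≥0}
  (μ : Measure (S × A)) [IsProbabilityMeasure μ] {κ : PDKernel (S × A)}

instance : IsProbabilityMeasure (M.sampleLaw π μ) := by
  unfold MDP.sampleLaw; infer_instance

theorem ae_norm_embeddedTD_le (hγ : γ < 1) (hκ1 : ∀ u, |κ.toFun u u| ≤ 1)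
    {f : S × A → ℝ} (hf : ∀ u, f u ∈ Icc (0 : ℝ) (timeConst γ)) :
    ∀ᵐ z ∂(M.sampleLaw π μ), ‖embeddedTD κ γ f z‖ ≤ timeConst γ := by
  have hr : ∀ᵐ z ∂(M.sampleLaw π μ), z.2.1 ∈ Icc (0 : ℝ) 1 := by
    refine (Measure.ae_compProd_iff
      ((measurable_fst.comp measurable_snd) measurableSet_Icc)).2 (.of_forall fun u => ?_)
    rw [Kernel.prod_apply]
    exact Measure.quasiMeasurePreserving_fst.ae (M.reward_mem u)
  filter_upwards [hr] with z hz
  rw [embeddedTD, norm_smul]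
  refine (mul_le_of_le_one_right (norm_nonneg _) (κ.norm_feature_le hκ1 _)).trans ?_
  have h1 := hf z.1
  have h2 := hf z.2.2
  have h3 := mul_le_mul_of_nonneg_left h2.2 γ.coe_nonneg
  have h4 := mul_nonneg γ.coe_nonneg h2.1
  have h5 := one_add_mul_timeConst hγ
  rw [Real.norm_eq_abs]
  exact abs_le.2 ⟨by linarith [h1.2, hz.1], by linarith [h1.1, hz.2]⟩

end Data

section DataMean

variable {S A : Type*} [TopologicalSpace S] [TopologicalSpace A]
  [MeasurableSpace S] [MeasurableSpace A] [CompactSpace (S × A)] [OpensMeasurableSpace (S × A)]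
  (M : MDP S A) (π : Kernel S A) [IsMarkovKernel π] {γ : ℝ≥0} (hγ : γ < 1)
  (μ : Measure (S × A)) [IsProbabilityMeasure μ]
  {κ : PDKernel (S × A)} (hκ : Continuous fun p : (S × A) × (S × A) => κ.toFun p.1 p.2)
  (hκ1 : ∀ u, |κ.toFun u u| ≤ 1)

include hκ in
theorem stronglyMeasurable_embeddedTD {f : S × A → ℝ} (hf : Measurable f) :
    StronglyMeasurable (embeddedTD κ γ f) := by
  have h1 : Measurable fun z : (S × A) × ℝ × (S × A) => z.2.1 + γ * f z.2.2 - f z.1 := by fun_prop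
  exact h1.stronglyMeasurable.smul
    ((κ.stronglyMeasurable_feature hκ).comp_measurable measurable_fst)

include hγ hκ hκ1

/-- The mean of the embedded temporal difference is the mean embedding of the negative Bellman
residual. -/
theorem norm_integral_embeddedTD {f : S × A → ℝ} (hfm : Measurable f)
    (hf : ∀ u, f u ∈ Icc (0 : ℝ) (timeConst γ)) :
    ‖∫ z, embeddedTD κ γ f z ∂(M.sampleLaw π μ)‖ =
      dualNorm κ μ (fun u => f u - M.bellman π γ f u) := by
  have hint : Integrable (embeddedTD κ γ f) (M.sampleLaw π μ) :=
    .of_bound (stronglyMeasurable_embeddedTD hκ hfm).aestronglyMeasurable _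
      (ae_norm_embeddedTD_le M π μ hγ hκ1 hf)
  rw [dualNorm_eq_norm_integral hκ hκ1 (M.integrable_sub_bellman π hγ μ hfm hfm hf hf),
    MDP.sampleLaw, Measure.integral_compProd hint, ← norm_neg, ← integral_neg]
  congr 1
  refine integral_congr_ae (.of_forall fun u => ?_)
  simp only [embeddedTD]
  rw [integral_smul_const, ← neg_smul]
  congr 1
  have i1 : Integrable (fun p : ℝ × (S × A) => p.1) ((M.reward u).prod (M.step π u)) :=
    (M.integrable_reward u).comp_fst _
  have i2 : Integrable (fun p : ℝ × (S × A) => (γ : ℝ) * f p.2)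
      ((M.reward u).prod (M.step π u)) :=
    ((Integrable.of_mem_Icc 0 (timeConst γ) hfm.aemeasurable (.of_forall hf)).comp_snd _).const_mul _
  rw [Kernel.prod_apply,
    integral_sub (f := fun p : ℝ × (S × A) => p.1 + γ * f p.2) (i1.add i2) (integrable_const _),
    integral_add i1 i2,
    integral_const_mul, integral_fun_fst (fun r : ℝ => r), integral_fun_snd f]
  simp [MDP.bellman]

end DataMean

/-! ### The selected estimate -/

section Rate

/-- With `L ≥ 1` the deviation of the averages, doubled, and the bias `C / H` of the averaged
iteration add up to at most `7 C (L / n)^{1/4}`; the bias, for `H` of order `n^{1/4}`, is the term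
that dictates the exponent `1/4`. -/
theorem deviation_add_bias_le {C L : ℝ} (hC : 0 ≤ C) (hL : 1 ≤ L) {n H : ℕ} (hn : 1 ≤ n)
    (hH : (n : ℝ) ^ (1 / 4 : ℝ) ≤ H) (hLn : L / n ≤ 1) :
    2 * (C / √n + C * √(2 * L / n)) + C / H ≤ 7 * C * (L / n) ^ (1 / 4 : ℝ) := by
  have hn0 : (0 : ℝ) < n := by exact_mod_cast hn
  have hx0 : 0 ≤ L / n := by positivity
  set q := (L / n) ^ (1 / 4 : ℝ) with hq
  have hq0 : 0 ≤ q := Real.rpow_nonneg hx0 _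
  have hq1 : q ≤ 1 := Real.rpow_le_one hx0 hLn (by norm_num)
  have hq2 : √(L / n) = q ^ 2 := by
    rw [hq, ← Real.rpow_natCast, ← Real.rpow_mul hx0, Real.sqrt_eq_rpow]
    norm_num
  have h1 : C / √n ≤ C * q := by
    have : 1 / √n ≤ √(L / n) := by
      rw [← Real.sqrt_one, ← Real.sqrt_div zero_le_one]
      exact Real.sqrt_le_sqrt (by gcongr)
    rw [div_eq_mul_one_div]
    exact mul_le_mul_of_nonneg_left (by nlinarith) hC
  have h2 : C * √(2 * L / n) ≤ 2 * (C * q) := by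
    have : √(2 * L / n) ≤ 2 * q ^ 2 := by
      rw [← hq2, show (2 : ℝ) * L / n = 2 * (L / n) by ring, Real.sqrt_mul (by norm_num)]
      exact mul_le_mul_of_nonneg_right (Real.sqrt_le_iff.2 (by norm_num)) (Real.sqrt_nonneg _)
    rw [mul_left_comm]
    exact mul_le_mul_of_nonneg_left (by nlinarith) hC
  have h3 : C / H ≤ C * q := by
    have hp : 0 < (n : ℝ) ^ (1 / 4 : ℝ) := Real.rpow_pos_of_pos hn0 _
    have : 1 / (H : ℝ) ≤ q := by
      refine (one_div_le_one_div_of_le hp hH).trans ?_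
      rw [hq, Real.div_rpow (by linarith) hn0.le]
      gcongr
      exact Real.one_le_rpow hL (by norm_num)
    rw [div_eq_mul_one_div]
    exact mul_le_mul_of_nonneg_left this hC
  linarith

end Rate

section Selection

variable {S A : Type*} [TopologicalSpace S] [TopologicalSpace A]
  [MeasurableSpace S] [MeasurableSpace A] [CompactSpace (S × A)] [OpensMeasurableSpace (S × A)]
  (M : MDP S A) (π : Kernel S A) [IsMarkovKernel π] {γ : ℝ≥0} (hγ : γ < 1)
  (μ : Measure (S × A)) [IsProbabilityMeasure μ]
  {κ : PDKernel (S × A)} (hκ : Continuous fun p : (S × A) × (S × A) => κ.toFun p.1 p.2)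
  (hκ1 : ∀ u, |κ.toFun u u| ≤ 1) {cands : Finset (Operator (S × A) (timeConst γ))}

include hγ hκ hκ1

/-- Uniform concentration: outside an event of probability `δ`, for every candidate the root of the
loss is within `C / √n + C √(2 L / n)` of the dual norm of the Bellman residual. The functions
`qBar X H` do not depend on the data, so that a union bound suffices. -/
theorem measure_exists_deviation_le (hc : cands.Nonempty) {n H : ℕ} (hn : 1 ≤ n) {δ : ℝ}
    (hδ : 0 < δ) :
    M.dataLaw π μ n {D | ∃ X ∈ cands,
      timeConst γ / √n + timeConst γ * √(2 * max 1 (Real.log (cands.card / δ)) / n) ≤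
        ‖(n : ℝ)⁻¹ • ∑ i, embeddedTD κ γ (qBar X H) (D i) -
          ∫ z, embeddedTD κ γ (qBar X H) z ∂(M.sampleLaw π μ)‖} ≤ ENNReal.ofReal δ := by
  have hn0 : (0 : ℝ) < n := by exact_mod_cast hn
  have hC0 : (0 : ℝ) < timeConst γ := one_pos.trans_le (one_le_timeConst hγ)
  have hcard : (0 : ℝ) < cands.card := by exact_mod_cast hc.card_pos
  set L := max 1 (Real.log (cands.card / δ)) with hL
  have hL0 : 0 ≤ L := zero_le_one.trans (le_max_left _ _)
  have hset : {D : Fin n → (S × A) × ℝ × (S × A) | ∃ X ∈ cands,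
      timeConst γ / √n + timeConst γ * √(2 * L / n) ≤
        ‖(n : ℝ)⁻¹ • ∑ i, embeddedTD κ γ (qBar X H) (D i) -
          ∫ z, embeddedTD κ γ (qBar X H) z ∂(M.sampleLaw π μ)‖} =
      ⋃ X ∈ cands, {D | timeConst γ / √n + timeConst γ * √(2 * L / n) ≤
        ‖(n : ℝ)⁻¹ • ∑ i, embeddedTD κ γ (qBar X H) (D i) -
          ∫ z, embeddedTD κ γ (qBar X H) z ∂(M.sampleLaw π μ)‖} := by
    ext D; simp
  have hexp : Real.exp (-(n * (timeConst γ * √(2 * L / n)) ^ 2) / (2 * (timeConst γ : ℝ) ^ 2)) ≤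
      δ / cands.card := by
    rw [mul_pow, Real.sq_sqrt (by positivity),
      show -((n : ℝ) * ((timeConst γ : ℝ) ^ 2 * (2 * L / n))) / (2 * (timeConst γ : ℝ) ^ 2) = -L by
        field_simp, Real.exp_neg, ← inv_div]
    refine inv_anti₀ (by positivity) ?_
    rw [← Real.exp_log (show 0 < cands.card / δ by positivity)]
    exact Real.exp_le_exp.2 (le_max_right _ _)
  rw [hset]
  refine (measure_biUnion_finset_le _ _).trans ((Finset.sum_le_sum fun X _ =>
    (measure_pi_norm_average_sub_ge_le (M.sampleLaw π μ) hC0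
      (stronglyMeasurable_embeddedTD hκ (measurable_qBar X H))
      (ae_norm_embeddedTD_le M π μ hγ hκ1 (qBar_mem X H)) hn (by positivity)).trans
      (ENNReal.ofReal_le_ofReal hexp)).trans ?_)
  rw [Finset.sum_const, nsmul_eq_mul, ← ENNReal.ofReal_natCast,
    ← ENNReal.ofReal_mul (Nat.cast_nonneg _), mul_div_cancel₀ _ hcard.ne']

/-- The Bellman residual of the selected estimate competes with the error of every candidate. -/
theorem measure_not_dualNorm_le (hc : cands.Nonempty) {n H : ℕ} (hn : 1 ≤ n)
    (hH : (n : ℝ) ^ (1 / 4 : ℝ) ≤ H)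
    {Xhat : (Fin n → (S × A) × ℝ × (S × A)) → Operator (S × A) (timeConst γ)}
    (hX : IsKLMFP γ κ cands n H Xhat) {δ : ℝ} (hδ : 0 < δ) :
    M.dataLaw π μ n {D | ¬ ∀ X ∈ cands,
      dualNorm κ μ (fun u => qBar (Xhat D) H u - M.bellman π γ (qBar (Xhat D) H) u) ≤
        bellmanErrorNorm M π γ μ κ X +
          7 * timeConst γ * (max 1 (Real.log (cands.card / δ)) / n) ^ (1 / 4 : ℝ)} ≤
      ENNReal.ofReal δ := by
  refine (measure_mono fun D hD => ?_).trans
    (measure_exists_deviation_le M π hγ μ hκ hκ1 hc (H := H) hn hδ)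
  by_contra hgood
  simp only [mem_ofPred_eq, not_exists, not_and, not_le] at hgood
  refine hD fun X hXc => ?_
  have hC0 : (0 : ℝ) ≤ timeConst γ := (timeConst γ).coe_nonneg
  set L := max 1 (Real.log (cands.card / δ)) with hL
  have hL1 : 1 ≤ L := le_max_left _ _
  have hH1 : 1 ≤ H := by
    have : (0 : ℝ) < H :=
      (Real.rpow_pos_of_pos (show (0 : ℝ) < n by exact_mod_cast hn) _).trans_le hH
    exact_mod_cast this
  rcases le_or_gt (L / n) 1 with hLn | hLn
  · have hdev : ∀ Y ∈ cands, |‖(n : ℝ)⁻¹ • ∑ i, embeddedTD κ γ (qBar Y H) (D i)‖ -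
        dualNorm κ μ (fun u => qBar Y H u - M.bellman π γ (qBar Y H) u)| ≤
        timeConst γ / √n + timeConst γ * √(2 * L / n) := by
      intro Y hY
      rw [← norm_integral_embeddedTD M π hγ μ hκ hκ1 (measurable_qBar Y H) (qBar_mem Y H)]
      exact (abs_norm_sub_norm_le _ _).trans (hgood Y hY).le
    have h1 := abs_le.1 (hdev _ (hX D).1)
    have h2 := abs_le.1 (hdev X hXc)
    have h3 := (hX D).2 X hXc
    rw [fixedPointLoss_eq, fixedPointLoss_eq] at h3
    have h4 := (sq_le_sq₀ (norm_nonneg _) (norm_nonneg _)).1 h3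
    have h5 := dualNorm_qBar_sub_bellman_le M π hγ μ hκ hκ1 X hH1
    have h6 := deviation_add_bias_le hC0 hL1 hn hH hLn
    linarith [h1.1, h2.2]
  · -- The residual never exceeds `C`, so the bound is trivial when `n` is small.
    have h1 := dualNorm_le κ hκ hκ1 (μ := μ)
      ((measurable_qBar (Xhat D) H).sub (M.measurable_bellman π γ (measurable_qBar (Xhat D) H)))
      (M.abs_sub_bellman_le π hγ (measurable_qBar (Xhat D) H) (qBar_mem _ H) (qBar_mem _ H))
    have h2 := bellmanErrorNorm_nonneg M π hγ μ hκ hκ1 X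
    have h3 : 1 ≤ (L / n) ^ (1 / 4 : ℝ) := Real.one_le_rpow hLn.le (by norm_num)
    have h4 := mul_le_mul_of_nonneg_left h3 (mul_nonneg (by norm_num : (0 : ℝ) ≤ 7) hC0)
    refine h1.trans ?_
    linarith

/-- For a candidate `X` of minimal criterion, a bound on the Bellman residual in terms of `‖ΔX‖`
turns into a bound on the suboptimality. -/
theorem exists_minimizer_subopt_le (hμ : ∀ h, M.marginal π h ≪ μ) (hc : cands.Nonempty) :
    ∃ X ∈ cands, ∀ (Y : Operator (S × A) (timeConst γ)) (H : ℕ) (η : ℝ),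
      dualNorm κ μ (fun u => qBar Y H u - M.bellman π γ (qBar Y H) u) ≤
        bellmanErrorNorm M π γ μ κ X + η →
      subopt M π γ cands hc (klmCriterion M π γ μ κ) (qBar Y H) ≤
        max 0 (klmLink M π γ μ κ (bellmanErrorNorm M π γ μ κ X + η) -
          klmLink M π γ μ κ (bellmanErrorNorm M π γ μ κ X)) := by
  obtain ⟨X, hX, hmin⟩ := Finset.exists_mem_eq_inf' hc (klmCriterion M π γ μ κ)
  refine ⟨X, hX, fun Y H η h => ?_⟩
  have h1 := abs_opeError_le_klmLink M π hγ hμ hκ hκ1 (measurable_qBar Y H) (qBar_mem Y H)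
  have h2 : klmLink M π γ μ κ (dualNorm κ μ fun u => qBar Y H u - M.bellman π γ (qBar Y H) u) ≤
      klmLink M π γ μ κ (bellmanErrorNorm M π γ μ κ X + η) :=
    linkFun_mono (dualNorm_nonneg κ hκ hκ1 (M.integrable_sub_bellman π hγ μ (measurable_qBar Y H)
      (measurable_qBar Y H) (qBar_mem Y H) (qBar_mem Y H))) h
  rw [subopt, hmin]
  exact max_le_max le_rfl (sub_le_sub_right (h1.trans h2) _)

/-- Optimality needs no density of `F_κ`: the link function is continuous from the right in any
case, being an infimum of affine functions. -/
theorem isOptimal_qBar (hμ : ∀ h, M.marginal π h ≪ μ) (hc : cands.Nonempty) {H : ℕ → ℕ}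
    {Xhat : ∀ n : ℕ, (Fin n → (S × A) × ℝ × (S × A)) → Operator (S × A) (timeConst γ)}
    (hH : ∀ n : ℕ, (n : ℝ) ^ (1 / 4 : ℝ) ≤ H n)
    (hX : ∀ n : ℕ, IsKLMFP γ κ cands n (H n) (Xhat n)) :
    IsOptimal M π γ μ cands hc (klmCriterion M π γ μ κ) (fun n D => qBar (Xhat n D) (H n)) := by
  intro ε hε
  obtain ⟨X, hXc, hsub⟩ := exists_minimizer_subopt_le M π hγ μ hκ hκ1 hμ hc
  have hX0 := bellmanErrorNorm_nonneg M π hγ μ hκ hκ1 X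
  obtain ⟨t, ht, hlink⟩ := exists_linkFun_add_le κ μ (timeConst γ) (M.weight π γ μ) hX0 hε
  rw [ENNReal.tendsto_nhds_zero]
  intro p hp
  obtain ⟨δ, hδ0, hδp⟩ : ∃ δ : ℝ, 0 < δ ∧ ENNReal.ofReal δ ≤ p := by
    obtain ⟨δ, -, h1, h2⟩ := ENNReal.lt_iff_exists_real_btwn.1 hp
    exact ⟨δ, ENNReal.ofReal_pos.1 h1, h2.le⟩
  set L := max 1 (Real.log (cands.card / δ)) with hL
  have hL0 : 0 < L := one_pos.trans_le (le_max_left _ _)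
  have hlim : Tendsto (fun n : ℕ => 7 * (timeConst γ : ℝ) * (L / n) ^ (1 / 4 : ℝ)) atTop (𝓝 0) := by
    have h1 : Tendsto (fun n : ℕ => L / (n : ℝ)) atTop (𝓝 0) :=
      tendsto_const_nhds.div_atTop tendsto_natCast_atTop_atTop
    have h2 := (h1.rpow_const (p := (1 / 4 : ℝ)) (Or.inr (by norm_num))).const_mul
      (7 * (timeConst γ : ℝ))
    rwa [Real.zero_rpow (by norm_num), mul_zero] at h2
  filter_upwards [hlim.eventually (ge_mem_nhds ht), eventually_ge_atTop 1] with n hnt hn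
  refine (measure_mono fun D hD hgood => ?_).trans
    ((measure_not_dualNorm_le M π hγ μ hκ hκ1 hc hn (hH n) (hX n) hδ0).trans hδp)
  have h1 := hsub _ _ _ (hgood X hXc)
  have h2 := hlink _ (by positivity) hnt
  have h3 : max 0 (klmLink M π γ μ κ (bellmanErrorNorm M π γ μ κ X +
      7 * timeConst γ * (L / n) ^ (1 / 4 : ℝ)) -
      klmLink M π γ μ κ (bellmanErrorNorm M π γ μ κ X)) ≤ ε :=
    max_le hε.le (sub_le_iff_le_add'.2 h2)
  exact absurd hD (not_lt.2 (h1.trans h3))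

/-- The rate: by subadditivity the link function grows by at most `φ(η) ≤ C ‖w‖ η`. -/
theorem measure_not_subopt_le (hμ : ∀ h, M.marginal π h ≪ μ) (hc : cands.Nonempty) {n H : ℕ}
    (hn : 1 ≤ n) (hH : (n : ℝ) ^ (1 / 4 : ℝ) ≤ H)
    {Xhat : (Fin n → (S × A) × ℝ × (S × A)) → Operator (S × A) (timeConst γ)}
    (hX : IsKLMFP γ κ cands n H Xhat) {δ : ℝ} (hδ : 0 < δ) :
    M.dataLaw π μ n {D | ¬ (
      ENNReal.ofReal (subopt M π γ cands hc (klmCriterion M π γ μ κ) (qBar (Xhat D) H)) ≤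
        ENNReal.ofReal (7 * (timeConst γ : ℝ) ^ 2 *
          (max 1 (Real.log (cands.card / δ)) / n) ^ (1 / 4 : ℝ)) *
          spaceENorm κ μ (M.weight π γ μ))} ≤ ENNReal.ofReal δ := by
  obtain ⟨X, hXc, hsub⟩ := exists_minimizer_subopt_le M π hγ μ hκ hκ1 hμ hc
  have hX0 := bellmanErrorNorm_nonneg M π hγ μ hκ hκ1 X
  refine (measure_mono fun D hD hgood => ?_).trans
    (measure_not_dualNorm_le M π hγ μ hκ hκ1 hc hn hH hX hδ)
  have hC0 : (0 : ℝ) < timeConst γ := one_pos.trans_le (one_le_timeConst hγ)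
  have hn0 : (0 : ℝ) < n := by exact_mod_cast hn
  have hL0 : 0 < max 1 (Real.log (cands.card / δ)) := one_pos.trans_le (le_max_left _ _)
  set η := 7 * timeConst γ * (max 1 (Real.log (cands.card / δ)) / n) ^ (1 / 4 : ℝ) with hη
  have hη0 : 0 < η := by positivity
  have h1 := hsub _ _ _ (hgood X hXc)
  have h2 : klmLink M π γ μ κ (bellmanErrorNorm M π γ μ κ X + η) ≤
      klmLink M π γ μ κ (bellmanErrorNorm M π γ μ κ X) + klmLink M π γ μ κ η :=
    linkFun_add_le hX0 hη0.le
  have h3 := h1.trans (max_le (linkFun_nonneg hη0.le) (sub_le_iff_le_add'.2 h2))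
  refine hD ((ENNReal.ofReal_le_ofReal h3).trans
    ((ofReal_linkFun_le (by exact_mod_cast hC0) hη0).trans_eq ?_))
  congr 2
  rw [hη]
  ring

end Selection

end OPE

theorem proposition8 :
    -- one universal constant `K` for all problems
    ∃ K : ℝ, 0 < K ∧
    ∀ {S A : Type*} [TopologicalSpace S] [TopologicalSpace A]
      [MeasurableSpace S] [MeasurableSpace A]
      [CompactSpace (S × A)] [OpensMeasurableSpace (S × A)]
      (M : OPE.MDP S A) (π : Kernel S A) [IsMarkovKernel π]
      (γ : ℝ≥0) (_hγ : γ < 1)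
      (μ : Measure (S × A)) [IsProbabilityMeasure μ]
      (_hexp : ∀ h : ℕ, M.marginal π h ≪ μ)
      (κ : OPE.PDKernel (S × A))
      (_hcont : Continuous fun p : (S × A) × (S × A) => κ.toFun p.1 p.2)
      (_hnorm : ∀ u, |κ.toFun u u| ≤ 1)
      (cands : Finset (OPE.Operator (S × A) (OPE.timeConst γ))) (hc : cands.Nonempty),
    -- the function defining the criterion is the link function of the master error bound
    (∀ Q : OPE.BFun (S × A) (OPE.timeConst γ),
      |M.opeError π γ Q.1| ≤ OPE.klmLink M π γ μ κ
        (OPE.dualNorm κ μ (fun u => Q.1 u - M.bellman π γ Q.1 u))) ∧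
    (∀ y : ℝ, 0 < y → ENNReal.ofReal (OPE.klmLink M π γ μ κ y) ≤
      ENNReal.ofReal (OPE.timeConst γ * y) * OPE.spaceENorm κ μ (M.weight π γ μ)) ∧
    (OPE.DenseInL1 κ μ → OPE.IsLinkFunction (OPE.klmLink M π γ μ κ)) ∧
    -- optimality with respect to the criterion
    (∀ (H : ℕ → ℕ)
      (Xhat : ∀ n : ℕ, (Fin n → (S × A) × ℝ × (S × A)) → OPE.Operator (S × A) (OPE.timeConst γ)),
      (∀ n : ℕ, (n : ℝ) ^ (1 / 4 : ℝ) ≤ H n) →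
      (∀ n : ℕ, OPE.IsKLMFP γ κ cands n (H n) (Xhat n)) →
      OPE.IsOptimal M π γ μ cands hc (OPE.klmCriterion M π γ μ κ)
        (fun n D => OPE.qBar (Xhat n D) (H n))) ∧
    -- the rate, with probability at least `1 - δ`
    (∀ (n H : ℕ)
      (Xhat : (Fin n → (S × A) × ℝ × (S × A)) → OPE.Operator (S × A) (OPE.timeConst γ)) (δ : ℝ),
      1 ≤ n → (n : ℝ) ^ (1 / 4 : ℝ) ≤ H →
      OPE.IsKLMFP γ κ cands n H Xhat →
      0 < δ → δ < 1 →
      M.dataLaw π μ n {D | ¬ (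
        ENNReal.ofReal (OPE.subopt M π γ cands hc (OPE.klmCriterion M π γ μ κ)
          (OPE.qBar (Xhat D) H)) ≤
        ENNReal.ofReal (K * (OPE.timeConst γ : ℝ) ^ 2 *
          (max 1 (Real.log (cands.card / δ)) / n) ^ (1 / 4 : ℝ)) *
          OPE.spaceENorm κ μ (M.weight π γ μ))} ≤ ENNReal.ofReal δ) := by
  refine ⟨7, by norm_num, ?_⟩
  intro S A _ _ _ _ _ _ M π _ γ hγ μ _ hμ κ hκ hκ1 cands hc
  have hC : 0 < OPE.timeConst γ := by
    exact_mod_cast one_pos.trans_le (OPE.one_le_timeConst hγ)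
  exact ⟨fun Q => OPE.abs_opeError_le_klmLink M π hγ hμ hκ hκ1 Q.2.1 Q.2.2,
    fun y hy => OPE.ofReal_linkFun_le hC hy,
    fun hd => OPE.isLinkFunction_linkFun hd (M.integrable_weight π hγ μ),
    fun H Xhat hH hX => OPE.isOptimal_qBar M π hγ μ hκ hκ1 hμ hc hH hX,
    fun n H Xhat δ hn hH hX hδ _ => OPE.measure_not_subopt_le M π hγ μ hκ hκ1 hμ hc hn hH hX hδ⟩
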